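/- **Conventions.** Let $\mathbb B$ be the category of the finite bipointed sets $[n]=\{\bot,x_1,\dots,x_n,\top\}$ ($n\ge 0$, $\bot\ne\top$) and maps preserving $\bot,\top$; let $\mathbb C_\times=\mathbb B^{\mathrm{op}}$, let $\mathsf{cSet}=[\mathbb C_\times^{\mathrm{op}},\mathsf{Set}]$ be the category of (cartesian) cubical sets, and let $\mathrm I^n$ be the presheaf represented by $[n]$. For $n\ge 1$ and $e\in\{0,1\}$ let $i:\sqcup^n_e\rightarrowtail \mathrm I^n$ be the open box: the union of all faces $\{x_j=d\}$ ($1\le j\le n$, $d\in\{0,1\}$) with $(j,d)\neq(1,e)$. Let $\pi:\mathrm I^{n}\to \mathrm I^{n-1}$ be the projection forgetting the first coordinate (the direction in which the box is open). A *normal uniform Kan fibration* is a map $f:X\to Y$ in $\mathsf{cSet}$ together with, for all $n\ge1$, $e$, $k\ge 0$ and all $a:\mathrm I^k\times \mathrm I^n\to Y$, $b:\mathrm I^k\times\sqcup^n_e\to X$ with $fb=a(1\times i)$, a chosen filler $\phi(a,b):\mathrm I^k\times \mathrm I^n\to X$ with $\phi(a,b)(1\times i)=b$ and $f\phi(a,b)=a$,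 such that $\phi(a,b)(\alpha\times 1)=\phi(a(\alpha\times1),b(\alpha\times1))$ for every $\alpha:\mathrm I^j\to \mathrm I^k$, and $\phi\bigl(fc(1\times\pi),\,c(1\times\pi i)\bigr)=c(1\times\pi)$ for every $c:\mathrm I^k\times \mathrm I^{n-1}\to X$. Morphisms are commutative squares preserving the chosen fillers. An *algebraic weak factorization system* on a category $\mathcal C$ is a functorial factorization $f=R(f)\circ L(f)$ together with a multiplication $\mu:R^2\to R$ making $R$, pointed by $L$, a monad on the arrow category $\mathcal C^{\to}$, and a comultiplication $\nu:L\to L^2$ making $L$, copointed by $R$, a comonad on $\mathcal C^{\to}$. For $f:X\to Y$ in $\mathsf{cSet}$ put $S_{n,e}(f)=X^{\sqcup^n_e}\times_{Y^{\sqcup^n_e}}Y^{\mathrm I^n}$ (so $S_{n,e}(f)=X^{\sqcup^n_e}$ if $Y=1$), and let $\delta=(X^{\pi i},\,Y^{\pi}f^{\mathrm I^{n-1}}):X^{\mathrm I^{n-1}}\to S_{n,e}(f)$. Let $\dot T(f)$ be the map to $Y$, induced by $f$ and by evaluation, from the pushout of $$\coprod_{n,e}\bigl(S_{n,e}(f)\times\sqcup^n_e\;+\;X^{\mathrm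 I^{n-1}}\times \mathrm I^n\bigr)\xrightarrow{[\mathrm{eval},\,\mathrm{eval}(1\times\pi)]}X$$ along $\coprod_{n,e}[1\times i,\ \delta\times1]$ with codomain $\coprod_{n,e}S_{n,e}(f)\times \mathrm I^n$. With the pushout coprojection $X\to\operatorname{dom}\dot T(f)$ and $1_Y$ as point $\dot t_f:f\to\dot T(f)$, this is a pointed endofunctor $(\dot T,\dot t)$ of $\mathsf{cSet}^{\to}$ that preserves codomains (hence restricts to each slice $\mathsf{cSet}/Y$). **Theorem.** There are an algebraic weak factorization system $(L,R)$ on $\mathsf{cSet}$ and a natural transformation $\eta:\dot T\to R$ such that 1. the category of algebras of the monad $R$ is isomorphic, over $\mathsf{cSet}^{\to}$, to the category of normal uniform Kan fibrations; 2. $\dot T$ preserves $\omega$-colimits (colimits of sequences indexed by $\mathbb N$); 3. $R$ is the algebraically free monad on $(\dot T,\dot t)$: $\eta\circ\dot t$ is the unit of $R$, and the functor $R\text{-}\mathrm{Alg}\to(\dot T,\dot t)\text{-}\mathrm{Alg}$ given by composing structure maps with $\eta$ is an isomorphism of categories, where a $(\dot T,\dot t)$-algebra is a map $\dot T g\to g$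 that is a retraction of $\dot t_g$; 4. $R$ is given by Kelly's construction: for every object $f$ of $\mathsf{cSet}^{\to}$ let $T_0=f$, $T_1=\dot T f$, $c_0=1$, $t_{n+1}=c_n\circ\dot t_{T_n}:T_n\to T_{n+1}$, and let $c_{n+1}:\dot T T_{n+1}\to T_{n+2}$ be the coequalizer of $\dot T(t_{n+1})$ and $\dot t_{T_{n+1}}\circ c_n$. Then $R(f)$ is a colimit of $T_0\to T_1\to T_2\to\cdots$, with coprojections $\kappa_n$ such that $\kappa_0$ is the unit of $R$ at $f$ and $\kappa_{n+1}\circ c_n=\mu_f\circ\eta_{R(f)}\circ\dot T(\kappa_n)$ for all $n$. -/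

import Mathlib

open CategoryTheory Limits MonoidalCategory

noncomputable section

/-! ### Algebraic weak factorization systems -/

section AWFS

universe v u

variable {C : Type u} [Category.{v} C]

/-- A functorial factorization on `C`: a functor `E : Arrow C ⥤ C` with natural maps
`L f : dom f ⟶ E f` and `R f : E f ⟶ cod f` such that `L f ≫ R f = f`. -/
structure FunctorialFactorization (C : Type u) [Category.{v} C] where
  E : Arrow C ⥤ C
  L : Arrow.leftFunc ⟶ E
  R : E ⟶ Arrow.rightFunc
  fac : L ≫ R = Arrow.leftToRight

namespace FunctorialFactorization

variable (F : FunctorialFactorization C)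

lemma fac_app (f : Arrow C) : F.L.app f ≫ F.R.app f = f.hom := by
  simpa using congr_app F.fac f

/-- The endofunctor `f ↦ L f` of the arrow category. -/
@[simps]
def left : Arrow C ⥤ Arrow C where
  obj f := Arrow.mk (F.L.app f)
  map {f g} h := Arrow.homMk h.left (F.E.map h) (F.L.naturality h)

/-- The endofunctor `f ↦ R f` of the arrow category. -/
@[simps]
def right : Arrow C ⥤ Arrow C where
  obj f := Arrow.mk (F.R.app f)
  map {f g} h := Arrow.homMk (F.E.map h) h.right (F.R.naturality h)

/-- The copoint `(1, R f) : L f ⟶ f`. -/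
@[simps]
def counit : F.left ⟶ 𝟭 (Arrow C) where
  app f := Arrow.homMk (𝟙 f.left) (F.R.app f) ((Category.id_comp _).trans (F.fac_app f).symm)
  naturality f g h := by
    ext1
    · exact (Category.comp_id h.left).trans (Category.id_comp h.left).symm
    · exact F.R.naturality h

/-- The point `(L f, 1) : f ⟶ R f`. -/
@[simps]
def unit : 𝟭 (Arrow C) ⟶ F.right where
  app f := Arrow.homMk (F.L.app f) (𝟙 f.right) ((F.fac_app f).trans (Category.comp_id _).symm)
  naturality f g h := by
    ext1
    · exact F.L.naturality h
    · exact (Category.comp_id h.right).trans (Category.id_comp h.right).symm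

end FunctorialFactorization

/-- An algebraic weak factorization system on `C`: a functorial factorization `(L, E, R)` with a
multiplication making `R` (pointed by `L`) a monad and a comultiplication making `L` (copointed
by `R`) a comonad. -/
structure AWFS (C : Type u) [Category.{v} C] extends FunctorialFactorization C where
  μ : toFunctorialFactorization.right ⋙ toFunctorialFactorization.right ⟶
    toFunctorialFactorization.right
  ν : toFunctorialFactorization.left ⟶
    toFunctorialFactorization.left ⋙ toFunctorialFactorization.left
  assoc : ∀ f : Arrow C,
    toFunctorialFactorization.right.map (μ.app f) ≫ μ.app f =
      μ.app (toFunctorialFactorization.right.obj f) ≫ μ.app f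
  left_unit : ∀ f : Arrow C,
    toFunctorialFactorization.unit.app (toFunctorialFactorization.right.obj f) ≫ μ.app f = 𝟙 _
  right_unit : ∀ f : Arrow C,
    toFunctorialFactorization.right.map (toFunctorialFactorization.unit.app f) ≫ μ.app f = 𝟙 _
  coassoc : ∀ f : Arrow C,
    ν.app f ≫ toFunctorialFactorization.left.map (ν.app f) =
      ν.app f ≫ ν.app (toFunctorialFactorization.left.obj f)
  left_counit : ∀ f : Arrow C,
    ν.app f ≫ toFunctorialFactorization.counit.app (toFunctorialFactorization.left.obj f) = 𝟙 _
  right_counit : ∀ f : Arrow C,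
    ν.app f ≫ toFunctorialFactorization.left.map (toFunctorialFactorization.counit.app f) = 𝟙 _

namespace AWFS

/-- The monad `(R, μ, L)` of an algebraic weak factorization system. -/
def monad (A : AWFS C) : Monad (Arrow C) where
  toFunctor := A.right
  η := A.unit
  μ := A.μ
  assoc := A.assoc
  left_unit := A.left_unit
  right_unit := A.right_unit

/-- The comonad `(L, ν, R)` of an algebraic weak factorization system. -/
def comonad (A : AWFS C) : Comonad (Arrow C) where
  toFunctor := A.left
  ε := A.counit
  δ := A.ν
  coassoc := A.coassoc
  left_counit := A.left_counit
  right_counit := A.right_counit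

end AWFS

end AWFS

/-! ### Pointed endofunctors, algebraically free monads, and Kelly's sequence -/

section Pointed

universe v u v₁ u₁ v₂ u₂

variable {C : Type u} [Category.{v} C]

/-- A functor is an isomorphism of categories. -/
def IsIsoOfCategories {A : Type u₁} [Category.{v₁} A] {B : Type u₂} [Category.{v₂} B]
    (F : A ⥤ B) : Prop :=
  ∃ G : B ⥤ A, F ⋙ G = 𝟭 A ∧ G ⋙ F = 𝟭 B

/-- The category of algebras of the pointed endofunctor `(T, t)`: objects `X` with a structure map
`T X ⟶ X` that is a retraction of `t_X`. -/
abbrev PointedAlgebra {T : C ⥤ C} (t : 𝟭 C ⟶ T) :=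
  ObjectProperty.FullSubcategory
    (fun A : Endofunctor.Algebra T => t.app A.a ≫ A.str = 𝟙 A.a)

/-- The comparison functor from the algebras of a monad `M` to the algebras of a pointed
endofunctor `(T, t)` that is induced by a map `η : (T, t) ⟶ M` of pointed endofunctors. -/
def comparison {T : C ⥤ C} {t : 𝟭 C ⟶ T} {M : Monad C} (η : T ⟶ M.toFunctor)
    (h : t ≫ η = M.η) : M.Algebra ⥤ PointedAlgebra t where
  obj A := ⟨⟨A.A, η.app A.A ≫ A.a⟩, by
    have h' := congr_app h A.A
    simp only [NatTrans.comp_app] at h'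
    rw [← Category.assoc, h', A.unit]⟩
  map {A B} g := ObjectProperty.homMk ⟨g.f, by simp [g.h]⟩

/-- `η` exhibits the monad `M` as the algebraically free monad on the pointed endofunctor
`(T, t)`. -/
def IsAlgebraicallyFree {T : C ⥤ C} (t : 𝟭 C ⟶ T) (M : Monad C) (η : T ⟶ M.toFunctor) : Prop :=
  ∃ h : t ≫ η = M.η, IsIsoOfCategories (comparison η h)

/-- A stage `c : T X ⟶ X'` of Kelly's sequence. -/
structure KellyStage (T : C ⥤ C) where
  src : C
  tgt : C
  c : T.obj src ⟶ tgt

variable [HasCoequalizers C] {T : C ⥤ C} (t : 𝟭 C ⟶ T)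

/-- The stages `c_n : T (T_n X) ⟶ T_{n+1} X` of Kelly's sequence: `T_0 X = X`, `T_1 X = T X`,
`c_0 = 1`, and `c_{n+1}` is the coequalizer of `T t_{n+1}` and `t_{T_{n+1} X} ∘ c_n`,
where `t_{n+1} = c_n ∘ t_{T_n X} : T_n X ⟶ T_{n+1} X`. -/
def kellyStage (X : C) : ℕ → KellyStage T
  | 0 => ⟨X, T.obj X, 𝟙 _⟩
  | n + 1 =>
    let s := kellyStage X n
    ⟨s.tgt, coequalizer (T.map (t.app s.src ≫ s.c)) (s.c ≫ t.app s.tgt), coequalizer.π _ _⟩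

/-- The object `T_n X` of Kelly's sequence. -/
def kellyObj (X : C) (n : ℕ) : C := (kellyStage t X n).src

/-- The map `c_n : T (T_n X) ⟶ T_{n+1} X`. -/
def kellyC (X : C) (n : ℕ) : T.obj (kellyObj t X n) ⟶ kellyObj t X (n + 1) :=
  (kellyStage t X n).c

/-- Kelly's sequence `X = T_0 X ⟶ T_1 X ⟶ T_2 X ⟶ ⋯`. -/
def kellySequence (X : C) : ℕ ⥤ C :=
  Functor.ofSequence (X := kellyObj t X) fun n => t.app (kellyObj t X n) ≫ kellyC t X n

/-- For every `X`, the object `M X` is the colimit of Kelly's sequence on `X`; the coprojections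
start with the unit of `M` at `X`, and the `T`-algebra structure
`T (M X) ⟶ M (M X) ⟶ M X` is the one induced by the maps `c_n`. -/
def IsKellyColimit (M : Monad C) (η : T ⟶ M.toFunctor) : Prop :=
  ∀ X : C, ∃ κ : kellySequence t X ⟶ (Functor.const ℕ).obj (M.obj X),
    Nonempty (IsColimit (Cocone.mk (M.obj X) κ)) ∧
    κ.app 0 = M.η.app X ∧
    ∀ n : ℕ, kellyC t X n ≫ κ.app (n + 1) =
      T.map (κ.app n) ≫ η.app (M.obj X) ≫ M.μ.app X

end Pointed

/-! ### Cartesian cubical sets -/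

/-- The bipointed set `[n] = {⊥, x_1, …, x_n, ⊤}`. -/
def bracket (n : ℕ) : Bipointed.{0} :=
  ⟨WithBot (WithTop (Fin n)), (⊥, ⊤)⟩

/-- The category `𝔹` of the finite strictly bipointed sets `[n]` and bipointed functions. -/
abbrev BipCat := InducedCategory Bipointed.{0} bracket

/-- The object `[n]` of the category `𝔹`. -/
abbrev bip (n : ℕ) : BipCat := n

/-- The element `x_i` of `[n]`. -/
def bipVar {n : ℕ} (i : Fin n) : bracket n := ((i : WithTop (Fin n)) : WithBot (WithTop (Fin n)))

/-- The element `⊥` (for `false`) or `⊤` (for `true`) of `[n]`. -/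
def bipPoint {n : ℕ} (d : Bool) : bracket n :=
  if d then (bracket n).toProd.2 else (bracket n).toProd.1

/-- The function underlying `bipHom`. -/
def bipFun {m n : ℕ} (g : Fin m → bracket n) : bracket m → bracket n :=
  WithBot.recBotCoe (bipPoint false) (WithTop.recTopCoe (bipPoint true) g)

/-- The bipointed function `[m] ⟶ [n]` sending `x_i` to `g i`. -/
def bipHom {m n : ℕ} (g : Fin m → bracket n) : bip m ⟶ bip n :=
  InducedCategory.homMk ⟨bipFun g, rfl, rfl⟩

/-- The category of cartesian cubes, `ℂ = 𝔹ᵒᵖ`. -/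
abbrev CubeCat := BipCatᵒᵖ

/-- The category of cartesian cubical sets. -/
abbrev CSet := CubeCatᵒᵖ ⥤ Type

/-- The object `[n]` of the category of cubes. -/
abbrev cube (n : ℕ) : CubeCat := Opposite.op (bip n)

/-- The geometric `n`-cube `Iⁿ`. -/
abbrev II (n : ℕ) : CSet := yoneda.obj (cube n)

/-- The face map `Iⁿ ⟶ Iⁿ⁺¹` onto the face where the `i`-th coordinate is `d`. -/
def face {n : ℕ} (i : Fin (n + 1)) (d : Bool) : II n ⟶ II (n + 1) :=
  yoneda.map (bipHom (i.insertNth (α := fun _ => bracket n) (bipPoint d) bipVar)).op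

/-- The projection `Iⁿ⁺¹ ⟶ Iⁿ` that forgets the first coordinate. -/
def proj (n : ℕ) : II (n + 1) ⟶ II n :=
  yoneda.map (bipHom fun i : Fin n => bipVar i.succ).op

/-- The open `(n+1)`-box in `Iⁿ⁺¹`, open in the first coordinate, as a subobject: the union of all
faces except the one where the first coordinate is `e`. -/
def boxSub (n : ℕ) (e : Bool) : Subfunctor (II (n + 1)) :=
  ⨆ p : {p : Fin (n + 1) × Bool // p ≠ (0, e)}, Subfunctor.range (face p.1.1 p.1.2)

/-- The open `(n+1)`-box, upper for `e = true` and lower for `e = false`. -/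
def box (n : ℕ) (e : Bool) : CSet := (boxSub n e).toFunctor

/-- The inclusion of the open `(n+1)`-box into `Iⁿ⁺¹`. -/
def boxι (n : ℕ) (e : Bool) : box n e ⟶ II (n + 1) := (boxSub n e).ι

/-! ### Normal uniform Kan fibrations -/

/-- A uniform Kan fibration structure on `f : Y ⟶ X`: chosen diagonal fillers `φ(a, b)` for the
generalized open boxes `Iᵏ × ⊔ⁿ⁺¹ ⟶ Iᵏ × Iⁿ⁺¹`, natural in `Iᵏ`. -/
structure UniformKanStructure {Y X : CSet} (f : Y ⟶ X) where
  fill (n : ℕ) (e : Bool) (k : ℕ) (a : II k ⊗ II (n + 1) ⟶ X) (b : II k ⊗ box n e ⟶ Y)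
    (w : b ≫ f = II k ◁ boxι n e ≫ a) : II k ⊗ II (n + 1) ⟶ Y
  fill_upper (n : ℕ) (e : Bool) (k : ℕ) (a : II k ⊗ II (n + 1) ⟶ X) (b : II k ⊗ box n e ⟶ Y)
    (w : b ≫ f = II k ◁ boxι n e ≫ a) : II k ◁ boxι n e ≫ fill n e k a b w = b
  fill_lower (n : ℕ) (e : Bool) (k : ℕ) (a : II k ⊗ II (n + 1) ⟶ X) (b : II k ⊗ box n e ⟶ Y)
    (w : b ≫ f = II k ◁ boxι n e ≫ a) : fill n e k a b w ≫ f = a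
  fill_natural (n : ℕ) (e : Bool) (j k : ℕ) (α : II j ⟶ II k)
    (a : II k ⊗ II (n + 1) ⟶ X) (b : II k ⊗ box n e ⟶ Y) (w : b ≫ f = II k ◁ boxι n e ≫ a) :
    α ▷ II (n + 1) ≫ fill n e k a b w =
      fill n e j (α ▷ II (n + 1) ≫ a) (α ▷ box n e ≫ b)
        (by rw [Category.assoc, w, whisker_exchange_assoc])

/-- A uniform Kan fibration structure is normal if the filler of every open box that is degenerate
in its open direction is degenerate: `φ(f c π, c π i) = c π`. -/
def UniformKanStructure.IsNormal {Y X : CSet} {f : Y ⟶ X} (φ : UniformKanStructure f) : Prop :=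
  ∀ (n : ℕ) (e : Bool) (k : ℕ) (c : II k ⊗ II n ⟶ Y),
    φ.fill n e k (II k ◁ proj n ≫ c ≫ f) (II k ◁ boxι n e ≫ II k ◁ proj n ≫ c) (by simp) =
      II k ◁ proj n ≫ c

/-- A normal uniform Kan fibration: a map of cubical sets with a normal uniform Kan fibration
structure. -/
structure NormalKanFibration where
  arrow : Arrow CSet
  str : UniformKanStructure arrow.hom
  normal : str.IsNormal

namespace NormalKanFibration

/-- Morphisms of normal uniform Kan fibrations: commutative squares preserving the fillers. -/
@[ext]
structure Hom (F G : NormalKanFibration) where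
  hom : F.arrow ⟶ G.arrow
  map_fill : ∀ (n : ℕ) (e : Bool) (k : ℕ) (a : II k ⊗ II (n + 1) ⟶ F.arrow.right)
    (b : II k ⊗ box n e ⟶ F.arrow.left) (w : b ≫ F.arrow.hom = II k ◁ boxι n e ≫ a),
    F.str.fill n e k a b w ≫ hom.left =
      G.str.fill n e k (a ≫ hom.right) (b ≫ hom.left)
        (by rw [Category.assoc, Arrow.w hom, reassoc_of% w])

instance : Category NormalKanFibration where
  Hom := Hom
  id F := ⟨𝟙 _, by intros; simp⟩
  comp {F G H} p q := ⟨p.hom ≫ q.hom, by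
    intro n e k a b w
    simp only [Arrow.comp_left, Arrow.comp_right]
    rw [← Category.assoc, p.map_fill, q.map_fill]
    simp only [Category.assoc]⟩

/-- The functor forgetting the fillers. -/
def forget : NormalKanFibration ⥤ Arrow CSet where
  obj F := F.arrow
  map p := p.hom

end NormalKanFibration

/-! ### The pointed endofunctor of normal box filling

For `f : X ⟶ Y` put `S_{n,e}(f) = X^⊔ ×_{Y^⊔} Y^(Iⁿ⁺¹)`, where `⊔` is the open `(n+1)`-box
with missing face `e`. The domain of `Ṫ f` is the pushout of

`∐_{n,e} (⊔ × S_{n,e}(f) + Iⁿ⁺¹ × X^(Iⁿ)) ⟶ X` along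
`∐_{n,e} (⊔ × S_{n,e}(f) + Iⁿ⁺¹ × X^(Iⁿ)) ⟶ ∐_{n,e} Iⁿ⁺¹ × S_{n,e}(f)`,

formed here naturally in `f`. For `Y = 1` one has `S_{n,e}(f) = X^⊔`. -/

/-- `f ↦ X^⊔ ×_{Y^⊔} Y^(Iⁿ⁺¹)`, the object of open boxes in `X` with a filler in `Y`. -/
def squares (n : ℕ) (e : Bool) : Arrow CSet ⥤ CSet :=
  pullback (Functor.whiskerRight Arrow.leftToRight (ihom (box n e)))
    (Functor.whiskerLeft Arrow.rightFunc (MonoidalClosed.pre (boxι n e)))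

/-- The projection `X^⊔ ×_{Y^⊔} Y^(Iⁿ⁺¹) ⟶ X^⊔`. -/
def squaresFst (n : ℕ) (e : Bool) : squares n e ⟶ Arrow.leftFunc ⋙ ihom (box n e) :=
  pullback.fst _ _

/-- The projection `X^⊔ ×_{Y^⊔} Y^(Iⁿ⁺¹) ⟶ Y^(Iⁿ⁺¹)`. -/
def squaresSnd (n : ℕ) (e : Bool) : squares n e ⟶ Arrow.rightFunc ⋙ ihom (II (n + 1)) :=
  pullback.snd _ _

lemma squares_condition (n : ℕ) (e : Bool) (f : Arrow CSet) :
    (squaresFst n e).app f ≫ (ihom (box n e)).map f.hom =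
      (squaresSnd n e).app f ≫ (MonoidalClosed.pre (boxι n e)).app f.right :=
  congr_app (pullback.condition (f := Functor.whiskerRight Arrow.leftToRight (ihom (box n e)))
    (g := Functor.whiskerLeft Arrow.rightFunc (MonoidalClosed.pre (boxι n e)))) f

/-- The map `(X^(πi), Y^π ∘ f^(Iⁿ)) : X^(Iⁿ) ⟶ X^⊔ ×_{Y^⊔} Y^(Iⁿ⁺¹)` of degenerate squares. -/
def degenerate (n : ℕ) (e : Bool) : Arrow.leftFunc ⋙ ihom (II n) ⟶ squares n e :=
  pullback.lift
    (Functor.whiskerLeft Arrow.leftFunc (MonoidalClosed.pre (boxι n e ≫ proj n)))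
    (Functor.whiskerRight Arrow.leftToRight (ihom (II n)) ≫
      Functor.whiskerLeft Arrow.rightFunc (MonoidalClosed.pre (proj n)))
    (by
      ext1; ext1 f
      have h₁ := (MonoidalClosed.pre (boxι n e)).naturality f.hom
      have h₂ := (MonoidalClosed.pre (proj n)).naturality f.hom
      simp only [MonoidalClosed.pre_map, NatTrans.comp_app, Functor.whiskerLeft_app,
        Functor.whiskerRight_app, Category.assoc]
      change _ ≫ _ ≫ (ihom (box n e)).map f.hom = (ihom (II n)).map f.hom ≫ _
      exact (congrArg _ h₁.symm).trans
        ((Category.assoc _ _ _).symm.trans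
          ((congrArg (· ≫ _) h₂.symm).trans (Category.assoc _ _ _))))

/-- Evaluation `⊔ × S_{n,e}(f) ⟶ X`. -/
def evalBox (n : ℕ) (e : Bool) : squares n e ⋙ tensorLeft (box n e) ⟶ Arrow.leftFunc :=
  Functor.whiskerRight (squaresFst n e) (tensorLeft (box n e)) ≫
    Functor.whiskerLeft Arrow.leftFunc (ihom.ev (box n e))

/-- Evaluation `Iⁿ⁺¹ × S_{n,e}(f) ⟶ Y`. -/
def evalCube (n : ℕ) (e : Bool) : squares n e ⋙ tensorLeft (II (n + 1)) ⟶ Arrow.rightFunc :=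
  Functor.whiskerRight (squaresSnd n e) (tensorLeft (II (n + 1))) ≫
    Functor.whiskerLeft Arrow.rightFunc (ihom.ev (II (n + 1)))

/-- The map `eval ∘ (π × 1) : Iⁿ⁺¹ × X^(Iⁿ) ⟶ X`. -/
def evalDegenerate (n : ℕ) :
    (Arrow.leftFunc ⋙ ihom (II n)) ⋙ tensorLeft (II (n + 1)) ⟶ (Arrow.leftFunc : _ ⥤ CSet) :=
  Functor.whiskerLeft (Arrow.leftFunc ⋙ ihom (II n)) ((curriedTensor CSet).map (proj n)) ≫
    Functor.whiskerLeft Arrow.leftFunc (ihom.ev (II n))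

/-- `f ↦ ⊔ × S_{n,e}(f) + Iⁿ⁺¹ × X^(Iⁿ)`. -/
def attachSource (n : ℕ) (e : Bool) : Arrow CSet ⥤ CSet :=
  (squares n e ⋙ tensorLeft (box n e)) ⨿
    ((Arrow.leftFunc ⋙ ihom (II n)) ⋙ tensorLeft (II (n + 1)))

/-- `[eval, eval ∘ (π × 1)] : ⊔ × S_{n,e}(f) + Iⁿ⁺¹ × X^(Iⁿ) ⟶ X`. -/
def attachTop (n : ℕ) (e : Bool) : attachSource n e ⟶ Arrow.leftFunc :=
  coprod.desc (evalBox n e) (evalDegenerate n)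

/-- `[i × 1, 1 × (degenerate squares)] : ⊔ × S_{n,e}(f) + Iⁿ⁺¹ × X^(Iⁿ) ⟶ Iⁿ⁺¹ × S_{n,e}(f)`. -/
def attachLeft (n : ℕ) (e : Bool) :
    attachSource n e ⟶ squares n e ⋙ tensorLeft (II (n + 1)) :=
  coprod.desc (Functor.whiskerLeft (squares n e) ((curriedTensor CSet).map (boxι n e)))
    (Functor.whiskerRight (degenerate n e) (tensorLeft (II (n + 1))))

/-- The sum over all dimensions and both ends of the maps `attachTop`. -/
def sumTop : (∐ fun p : ℕ × Bool => attachSource p.1 p.2) ⟶ Arrow.leftFunc :=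
  Sigma.desc fun p => attachTop p.1 p.2

/-- The sum over all dimensions and both ends of the maps `attachLeft`. -/
def sumLeft : (∐ fun p : ℕ × Bool => attachSource p.1 p.2) ⟶
    ∐ fun p : ℕ × Bool => squares p.1 p.2 ⋙ tensorLeft (II (p.1 + 1)) :=
  Limits.Sigma.map fun p => attachLeft p.1 p.2

lemma box_condition_aux {A B S X Y : CSet} (i : B ⟶ A) (f : X ⟶ Y) (p : S ⟶ (ihom B).obj X)
    (q : S ⟶ (ihom A).obj Y) (h : p ≫ (ihom B).map f = q ≫ (MonoidalClosed.pre i).app Y) :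
    i ▷ S ≫ A ◁ q ≫ (ihom.ev A).app Y = (B ◁ p ≫ (ihom.ev B).app X) ≫ f := by
  rw [Category.assoc, ← ihom.ev_naturality, ← MonoidalCategory.whiskerLeft_comp_assoc, h,
    ← whisker_exchange_assoc, MonoidalCategory.whiskerLeft_comp, Category.assoc,
    MonoidalClosed.id_tensor_pre_app_comp_ev]

lemma degenerate_condition_aux {A B S X Y : CSet} (π : A ⟶ B) (f : X ⟶ Y)
    (d : (ihom B).obj X ⟶ S) (q : S ⟶ (ihom A).obj Y)
    (h : d ≫ q = (ihom B).map f ≫ (MonoidalClosed.pre π).app Y) :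
    A ◁ d ≫ A ◁ q ≫ (ihom.ev A).app Y = (π ▷ _ ≫ (ihom.ev B).app X) ≫ f := by
  rw [← MonoidalCategory.whiskerLeft_comp_assoc, h, Category.assoc, ← ihom.ev_naturality,
    MonoidalCategory.whiskerLeft_comp, Category.assoc,
    MonoidalClosed.id_tensor_pre_app_comp_ev, whisker_exchange_assoc]

lemma box_condition (n : ℕ) (e : Bool) :
    Functor.whiskerLeft (squares n e) ((curriedTensor CSet).map (boxι n e)) ≫ evalCube n e =
      evalBox n e ≫ Arrow.leftToRight := by
  ext1; ext1 f
  exact box_condition_aux _ _ _ _ (squares_condition n e f)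

lemma degenerate_snd (n : ℕ) (e : Bool) :
    degenerate n e ≫ squaresSnd n e =
      Functor.whiskerRight Arrow.leftToRight (ihom (II n)) ≫
        Functor.whiskerLeft Arrow.rightFunc (MonoidalClosed.pre (proj n)) :=
  pullback.lift_snd _ _ _

lemma degenerate_condition (n : ℕ) (e : Bool) :
    Functor.whiskerRight (degenerate n e) (tensorLeft (II (n + 1))) ≫ evalCube n e =
      evalDegenerate n ≫ Arrow.leftToRight := by
  ext1; ext1 f
  exact degenerate_condition_aux (proj n) f.hom _ _ (congr_app (degenerate_snd n e) f)

lemma attach_condition (n : ℕ) (e : Bool) :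
    attachLeft n e ≫ evalCube n e = attachTop n e ≫ Arrow.leftToRight :=
  (coprod.desc_comp _ _ _).trans
    ((congrArg₂ coprod.desc (box_condition n e) (degenerate_condition n e)).trans
      (coprod.desc_comp _ _ _).symm)

/-- The domain of `Ṫ f`, as a functor of `f`. -/
def tDotObj : Arrow CSet ⥤ CSet := pushout sumLeft sumTop

/-- The map `Ṫ f`, as a natural transformation from its domain to the codomain of `f`. -/
def tDotHom : tDotObj ⟶ Arrow.rightFunc :=
  pushout.desc (Sigma.desc fun p => evalCube p.1 p.2) Arrow.leftToRight (by
    refine Sigma.hom_ext _ _ fun p => ?_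
    simp [sumLeft, sumTop, attach_condition])

/-- The pushout coprojection `X ⟶ dom (Ṫ f)`. -/
def tDotIncl : Arrow.leftFunc ⟶ tDotObj := pushout.inr _ _

lemma tDotIncl_hom (f : Arrow CSet) : tDotIncl.app f ≫ tDotHom.app f = f.hom :=
  congr_app (pushout.inr_desc (f := sumLeft) (g := sumTop) _ _ _) f

/-- The endofunctor `Ṫ` of the arrow category of cubical sets. It preserves codomains, so that it
restricts to an endofunctor of each slice. -/
def tDot : Arrow CSet ⥤ Arrow CSet where
  obj f := Arrow.mk (tDotHom.app f)
  map {f g} h := Arrow.homMk (tDotObj.map h) h.right (tDotHom.naturality h)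

/-- The point `1 ⟶ Ṫ`. -/
def tDotPoint : 𝟭 (Arrow CSet) ⟶ tDot where
  app f := Arrow.homMk (tDotIncl.app f) (𝟙 f.right) 
    ((tDotIncl_hom f).trans (Category.comp_id _).symm)
  naturality f g h := by
    ext1
    · exact tDotIncl.naturality h
    · exact (Category.comp_id _).trans (Category.id_comp _).symm

end

/-! ### Algebras of a pointed endofunctor and algebraically free monads -/

section

universe v u v₁ u₁ v₂ u₂

/-! A `Ṫ`-algebra is a normal uniform Kan fibration. Since `ṫ` is the identity on codomains, an
algebra on `f : X ⟶ Y` is a map `dom (Ṫ f) ⟶ X` over `Y` that restricts to the identity of `X`. By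
the pushout this is a filler for the universal square over each `S_{n,e}(f)`, degenerate on
degenerate squares. Maps `Iᵏ ⟶ S_{n,e}(f)` are the filling problems with parameters in `Iᵏ`, so by
Yoneda a universal filler is a family of fillers natural in `Iᵏ` (`exists_ofKan`, `map_comm_iff`,
`isIsoOfCategories_algebraToKan`).

`Ṫ` preserves colimits of sequences because it is built by colimits and pullbacks from exponentials
by boxes and cubes. The product of such an object `P` with a cube is finite: a map out of it amounts
to finitely many values and equations in bounded dimension, all attained at a finite stage
(`exists_extension`, `preservesColimitsOfShape_coyoneda`). Hence Kelly's sequence converges at `ω`,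
and its colimit is the free algebra (`isFreePointedAlgebra_of_isColimit`).

Every identity map is an algebra, and every map from an algebra to it is an algebra map. The free
algebra on `f` therefore has the codomain of `f` up to isomorphism, and can be transported to have
exactly that codomain (`nonempty_kellyColimit`). This gives the factorization and the monad. Normal
fibrations compose, so the universal property also yields a comultiplication, by lifting into the
composite of `R (L f)` and `R f`; the laws follow from uniqueness of lifts. Finally `η` is `Ṫ` of
the unit followed by the free algebra structure, and `η` followed by `μ` recovers that structure
(`tDotToKan_mul`), so the freeness of `R f` as an algebra makes the monad algebraically free. -/

lemma Functor.eq_id_of_comp_faithful {A : Type u₁} [Category.{v₁} A] {D : Type u₂}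
    [Category.{v₂} D] {H : A ⥤ A} (U : A ⥤ D) [U.Faithful] (hobj : ∀ X, H.obj X = X)
    (hU : H ⋙ U = U) : H = 𝟭 A := by
  refine CategoryTheory.Functor.ext hobj fun X Y f => U.map_injective ?_
  have h := Functor.congr_hom hU f
  simp only [Functor.comp_map] at h
  simp [h, eqToHom_map]

/-- Over a common base with faithful forgetful functors, equality on morphisms can be tested in the
base. Only the equalities of objects remain to be supplied. -/
lemma isIsoOfCategories_of_comp_faithful {A : Type u₁} [Category.{v₁} A] {B : Type u₂}
    [Category.{v₂} B] {D : Type u} [Category.{v} D] (UA : A ⥤ D) (UB : B ⥤ D) [UA.Faithful]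
    [UB.Faithful] (F : A ⥤ B) (G : B ⥤ A) (hF : F ⋙ UB = UA) (hG : G ⋙ UA = UB)
    (h₁ : ∀ X, G.obj (F.obj X) = X) (h₂ : ∀ Y, F.obj (G.obj Y) = Y) : IsIsoOfCategories F :=
  ⟨G, Functor.eq_id_of_comp_faithful UA h₁ (by rw [Functor.assoc, hG, hF]),
    Functor.eq_id_of_comp_faithful UB h₂ (by rw [Functor.assoc, hF, hG])⟩

lemma IsIsoOfCategories.comp {A : Type u₁} [Category.{v₁} A] {B : Type u₂}
    [Category.{v₂} B] {D : Type u} [Category.{v} D] {F : A ⥤ B} {G : B ⥤ D}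
    (hF : IsIsoOfCategories F) (hG : IsIsoOfCategories G) : IsIsoOfCategories (F ⋙ G) := by
  obtain ⟨F', h₁, h₂⟩ := hF
  obtain ⟨G', h₃, h₄⟩ := hG
  refine ⟨G' ⋙ F', ?_, ?_⟩
  · rw [Functor.assoc, ← Functor.assoc G, h₃, Functor.id_comp, h₁]
  · rw [Functor.assoc, ← Functor.assoc F', h₂, Functor.id_comp, h₄]

variable {C : Type u} [Category.{v} C] {T : C ⥤ C} (t : 𝟭 C ⟶ T)

/-- The functor forgetting the structure map of an algebra of a pointed endofunctor. -/
def PointedAlgebra.forget : PointedAlgebra t ⥤ C :=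
  ObjectProperty.ι _ ⋙ Endofunctor.Algebra.forget T

instance : (PointedAlgebra.forget t).Faithful := by
  unfold PointedAlgebra.forget; infer_instance

/-- The algebra `(A, s)` is free on `X` along `u : X ⟶ A`: every map from `X` to an algebra
extends uniquely to an algebra map. -/
structure IsFreePointedAlgebra {X A : C} (s : T.obj A ⟶ A) (u : X ⟶ A) : Prop where
  retract : t.app A ≫ s = 𝟙 A
  exists_lift : ∀ {B : C} (r : T.obj B ⟶ B), t.app B ≫ r = 𝟙 B → ∀ f : X ⟶ B,
    ∃ g : A ⟶ B, s ≫ g = T.map g ≫ r ∧ u ≫ g = f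
  hom_ext : ∀ {B : C} (r : T.obj B ⟶ B), t.app B ≫ r = 𝟙 B → ∀ g h : A ⟶ B,
    s ≫ g = T.map g ≫ r → s ≫ h = T.map h ≫ r → u ≫ g = u ≫ h → g = h

variable {t}

lemma point_naturality (t : 𝟭 C ⟶ T) {A B : C} (f : A ⟶ B) :
    t.app A ≫ T.map f = f ≫ t.app B :=
  (t.naturality f).symm

/-- A monad under a pointed endofunctor all of whose free algebras are free for the pointed
endofunctor is algebraically free. -/
lemma isAlgebraicallyFree_of_isFreePointedAlgebra {M : Monad C} {η : T ⟶ M.toFunctor}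
    (h : t ≫ η = M.η)
    (hfree : ∀ X, IsFreePointedAlgebra t (η.app (M.obj X) ≫ M.μ.app X) (M.η.app X)) :
    IsAlgebraicallyFree t M η := by
  have happ (X : C) : t.app X ≫ η.app X = M.η.app X := congr_app h X
  have hnat {X Y : C} (f : X ⟶ Y) : T.map f ≫ η.app Y = η.app X ≫ M.map f := η.naturality f
  have hunit {X Y : C} (f : X ⟶ Y) : M.η.app X ≫ M.map f = f ≫ M.η.app Y :=
    (M.η.naturality f).symm
  have hμ {X Y : C} (f : X ⟶ Y) : M.map (M.map f) ≫ M.μ.app Y = M.μ.app X ≫ M.map f :=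
    M.μ.naturality f
  have hlu (X : C) : M.η.app (M.obj X) ≫ M.μ.app X = 𝟙 (M.obj X) := M.left_unit X
  have hru (X : C) : M.map (M.η.app X) ≫ M.μ.app X = 𝟙 (M.obj X) := M.right_unit X
  have hass (X : C) : M.map (M.μ.app X) ≫ M.μ.app X = M.μ.app (M.obj X) ≫ M.μ.app X := M.assoc X
  -- The candidate `M`-action on a `T`-algebra is the algebra map from the free algebra that extends
  -- the identity.
  have key {A : C} (r : T.obj A ⟶ A) (hr : t.app A ≫ r = 𝟙 A) : ∃ a : M.obj A ⟶ A,
      η.app (M.obj A) ≫ M.μ.app A ≫ a = T.map a ≫ r ∧ M.η.app A ≫ a = 𝟙 A := by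
    simpa only [Category.assoc] using (hfree A).exists_lift r hr (𝟙 A)
  have hext {X A : C} (r : T.obj A ⟶ A) (hr : t.app A ≫ r = 𝟙 A) (g g' : M.obj X ⟶ A)
      (h1 : η.app (M.obj X) ≫ M.μ.app X ≫ g = T.map g ≫ r)
      (h2 : η.app (M.obj X) ≫ M.μ.app X ≫ g' = T.map g' ≫ r)
      (h3 : M.η.app X ≫ g = M.η.app X ≫ g') : g = g' :=
    (hfree X).hom_ext r hr g g' (by rwa [Category.assoc]) (by rwa [Category.assoc]) h3
  have hstr {A : C} (r : T.obj A ⟶ A) (a : M.obj A ⟶ A)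
      (h1 : η.app (M.obj A) ≫ M.μ.app A ≫ a = T.map a ≫ r) (h2 : M.η.app A ≫ a = 𝟙 A) :
      η.app A ≫ a = r := by
    have h3 : η.app A = T.map (M.η.app A) ≫ η.app (M.obj A) ≫ M.μ.app A := by
      rw [reassoc_of% hnat (M.η.app A), hru, Category.comp_id]
    rw [h3, Category.assoc, Category.assoc, h1, ← T.map_comp_assoc, h2]
    exact (congrArg (· ≫ r) (T.map_id A)).trans (Category.id_comp r)
  have hmap {A : C} (α : M.obj A ⟶ A) (hα : M.μ.app A ≫ α = M.map α ≫ α) :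
      η.app (M.obj A) ≫ M.μ.app A ≫ α = T.map α ≫ η.app A ≫ α := by
    rw [hα, reassoc_of% hnat α]
  -- Both sides are `T`-algebra maps out of the free algebra on `M A`, and both restrict to `a`
  -- along the unit.
  have hassoc {A : C} (r : T.obj A ⟶ A) (hr : t.app A ≫ r = 𝟙 A) (a : M.obj A ⟶ A)
      (h1 : η.app (M.obj A) ≫ M.μ.app A ≫ a = T.map a ≫ r) (h2 : M.η.app A ≫ a = 𝟙 A) :
      M.μ.app A ≫ a = M.map a ≫ a := by
    refine hext r hr _ _ ?_ ?_ ?_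
    · rw [← reassoc_of% hass A, ← reassoc_of% hnat (M.μ.app A), h1, T.map_comp_assoc]
    · rw [← reassoc_of% hμ a, ← reassoc_of% hnat (M.map a), h1, T.map_comp_assoc]
    · rw [reassoc_of% hlu A, reassoc_of% hunit a, h2, Category.comp_id]
  have hhom {A B : C} (r : T.obj A ⟶ A) (r' : T.obj B ⟶ B) (hr' : t.app B ≫ r' = 𝟙 B)
      (a : M.obj A ⟶ A) (h1 : η.app (M.obj A) ≫ M.μ.app A ≫ a = T.map a ≫ r)
      (h2 : M.η.app A ≫ a = 𝟙 A)
      (b : M.obj B ⟶ B) (h1' : η.app (M.obj B) ≫ M.μ.app B ≫ b = T.map b ≫ r')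
      (h2' : M.η.app B ≫ b = 𝟙 B) (g : A ⟶ B) (hg : T.map g ≫ r' = r ≫ g) :
      M.map g ≫ b = a ≫ g := by
    refine hext r' hr' _ _ ?_ ?_ ?_
    · rw [← reassoc_of% hμ g, ← reassoc_of% hnat (M.map g), h1', T.map_comp_assoc]
    · rw [reassoc_of% h1, ← hg, T.map_comp_assoc]
    · rw [reassoc_of% hunit g, h2', reassoc_of% h2, Category.comp_id]
  choose a ha₁ ha₂ using fun A : PointedAlgebra t => key A.obj.str A.property
  let G : PointedAlgebra t ⥤ M.Algebra :=
    { obj A := ⟨A.obj.a, a A, ha₂ A, hassoc A.obj.str A.property _ (ha₁ A) (ha₂ A)⟩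
      map {A B} g := ⟨g.hom.f, hhom A.obj.str B.obj.str B.property _ (ha₁ A) (ha₂ A) _ (ha₁ B)
        (ha₂ B) _ g.hom.h⟩ }
  refine ⟨h, isIsoOfCategories_of_comp_faithful M.forget (PointedAlgebra.forget t) _ G rfl rfl
    ?_ ?_⟩
  -- An `M`-action is itself a `T`-algebra map extending the identity, so it equals the chosen one.
  · rintro ⟨A, α, hu, hα⟩
    have : a ((comparison η h).obj ⟨A, α, hu, hα⟩) = α :=
      hext (η.app A ≫ α) (by rw [← Category.assoc, happ, hu]) _ _
        (ha₁ ((comparison η h).obj ⟨A, α, hu, hα⟩)) (hmap α hα)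
        ((ha₂ ((comparison η h).obj ⟨A, α, hu, hα⟩)).trans hu.symm)
    simp only [G, this]
    rfl
  · rintro ⟨⟨A, α⟩, hα⟩
    have := hstr α _ (ha₁ ⟨⟨A, α⟩, hα⟩) (ha₂ ⟨⟨A, α⟩, hα⟩)
    simp only [G, comparison]
    congr 2

/-! ### Convergence of Kelly's sequence -/

variable [HasCoequalizers C]

lemma kellySequence_map_succ (X : C) (n : ℕ) :
    (kellySequence t X).map (homOfLE n.le_succ) = t.app (kellyObj t X n) ≫ kellyC t X n :=
  Functor.ofSequence_map_homOfLE_succ _ _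

lemma kellyC_condition (X : C) (n : ℕ) :
    T.map (t.app (kellyObj t X n) ≫ kellyC t X n) ≫ kellyC t X (n + 1) =
      kellyC t X n ≫ t.app (kellyObj t X (n + 1)) ≫ kellyC t X (n + 1) :=
  (coequalizer.condition _ _).trans (Category.assoc _ _ _)

lemma kellyC_desc {X A : C} (n : ℕ) (f : T.obj (kellyObj t X (n + 1)) ⟶ A)
    (hf : T.map (t.app (kellyObj t X n) ≫ kellyC t X n) ≫ f =
      kellyC t X n ≫ t.app (kellyObj t X (n + 1)) ≫ f) :
    ∃ g : kellyObj t X (n + 2) ⟶ A, kellyC t X (n + 1) ≫ g = f :=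
  ⟨coequalizer.desc f (hf.trans (Category.assoc _ _ _).symm), coequalizer.π_desc _ _⟩

lemma kellyC_epi (X : C) : ∀ n : ℕ, Epi (kellyC t X n)
  | 0 => inferInstanceAs (Epi (𝟙 (T.obj X)))
  | _ + 1 => coequalizer.π_epi

/-- The maps from Kelly's sequence on `X` to an algebra `B` that extend `f : X ⟶ B`. -/
lemma exists_kellyMap {X B : C} (r : T.obj B ⟶ B) (hr : t.app B ≫ r = 𝟙 B) (f : X ⟶ B) :
    ∃ p : ∀ n, kellyObj t X n ⟶ B, p 0 = f ∧
      ∀ n, kellyC t X n ≫ p (n + 1) = T.map (p n) ≫ r := by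
  -- The recursion carries two consecutive maps, because the equation relating them is what allows
  -- the next one to be constructed.
  let P (n : ℕ) : Type _ := {p : (kellyObj t X n ⟶ B) × (kellyObj t X (n + 1) ⟶ B) //
    kellyC t X n ≫ p.2 = T.map p.1 ≫ r}
  have step (n : ℕ) (p : P n) : ∃ q : P (n + 1), q.1.1 = p.1.2 := by
    obtain ⟨⟨p₁, p₂⟩, hp⟩ := p
    dsimp only at hp
    -- By naturality of `t` and the retraction law, both legs of the fork collapse to `T.map p₁ ≫
    -- r`.
    obtain ⟨g, hg⟩ := kellyC_desc n (T.map p₂ ≫ r) (by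
      rw [← T.map_comp_assoc, Category.assoc, hp, ← Category.assoc (t.app _), point_naturality,
        Category.assoc, hr, Category.comp_id, reassoc_of% point_naturality t p₂, hr,
        Category.comp_id, hp])
    exact ⟨⟨(p₂, g), hg⟩, rfl⟩
  choose next hnext using step
  let p (n : ℕ) : P n := Nat.rec (motive := P) ⟨(f, T.map f ≫ r), Category.id_comp _⟩ next n
  refine ⟨fun n => (p n).1.1, rfl, fun n => ?_⟩
  have : (p (n + 1)).1.1 = (p n).1.2 := hnext n (p n)
  have h := (p n).2
  rw [← this] at h
  exact h

/-- The cocone on Kelly's sequence given by a compatible family of maps. -/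
noncomputable def kellyCocone {X B : C} (p : ∀ n, kellyObj t X n ⟶ B)
    (hp : ∀ n, t.app _ ≫ kellyC t X n ≫ p (n + 1) = p n) :
    Cocone (kellySequence t X) where
  pt := B
  ι := NatTrans.ofSequence p fun n => by
    rw [kellySequence_map_succ]
    exact ((Category.assoc _ _ _).trans (hp n)).trans (Category.comp_id _).symm

/-- The coprojections of a cocone on Kelly's sequence. -/
noncomputable def kellyι {X : C} (K : Cocone (kellySequence t X)) (n : ℕ) : kellyObj t X n ⟶ K.pt :=
  K.ι.app n

variable {X : C} {K : Cocone (kellySequence t X)}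

lemma point_kellyC_kellyι (n : ℕ) :
    t.app (kellyObj t X n) ≫ kellyC t X n ≫ kellyι K (n + 1) = kellyι K n := by
  have := K.w (homOfLE n.le_succ)
  rw [kellySequence_map_succ] at this
  exact (Category.assoc _ _ _).symm.trans this

lemma kelly_hom_ext (hK : IsColimit K) {B : C} {g h : K.pt ⟶ B}
    (w : ∀ n, kellyι K n ≫ g = kellyι K n ≫ h) : g = h :=
  hK.hom_ext w

lemma kelly_map_hom_ext (hK : IsColimit K) [PreservesColimitsOfShape ℕ T] {B : C}
    {g h : T.obj K.pt ⟶ B} (w : ∀ n, T.map (kellyι K n) ≫ g = T.map (kellyι K n) ≫ h) : g = h :=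
  (isColimitOfPreserves T hK).hom_ext w

/-- A colimit of Kelly's sequence that is preserved by `T` has a structure map. -/
lemma exists_kellyColimit_structure (hK : IsColimit K) [PreservesColimitsOfShape ℕ T] :
    ∃ s : T.obj K.pt ⟶ K.pt, ∀ n, T.map (kellyι K n) ≫ s = kellyC t X n ≫ kellyι K (n + 1) := by
  -- The legs `c_n ≫ κ_{n+1}` are compatible by the coequalizer equation followed by the cocone law.
  let c : Cocone (kellySequence t X ⋙ T) :=
    { pt := K.pt
      ι := NatTrans.ofSequence (fun n => (kellyC t X n ≫ kellyι K (n + 1))) fun n => by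
        rw [Functor.comp_map, kellySequence_map_succ]
        have h := congrArg (· ≫ kellyι K (n + 2)) (kellyC_condition (t := t) X n)
        simp only [Category.assoc, point_kellyC_kellyι] at h
        exact h.trans (Category.comp_id _).symm }
  exact ⟨(isColimitOfPreserves T hK).desc c, (isColimitOfPreserves T hK).fac c⟩

/-- Since `T` preserves the colimit, algebra maps out of it can be tested on stages: they are
families with `c_n ≫ p_{n+1} = T p_n ≫ r`. Such a family exists for each `p_0` by the coequalizer
property, and is unique because every `c_n` is epi. -/
lemma isFreePointedAlgebra_of_isColimit (hK : IsColimit K) [PreservesColimitsOfShape ℕ T]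
    {s : T.obj K.pt ⟶ K.pt}
    (hs : ∀ n, T.map (kellyι K n) ≫ s = kellyC t X n ≫ kellyι K (n + 1)) {u : X ⟶ K.pt}
    (hu : kellyι K 0 = u) : IsFreePointedAlgebra t s u where
  retract := kelly_hom_ext hK fun n => by
    rw [← reassoc_of% point_naturality t (kellyι K n), hs, point_kellyC_kellyι, Category.comp_id]
  exists_lift {B} r hr f := by
    obtain ⟨p, hp₀, hp⟩ := exists_kellyMap (t := t) r hr f
    have hp' (n : ℕ) : t.app _ ≫ kellyC t X n ≫ p (n + 1) = p n := by
      rw [hp, reassoc_of% point_naturality t (p n), hr, Category.comp_id]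
    obtain ⟨d, hfac⟩ : ∃ d : K.pt ⟶ B, ∀ n, kellyι K n ≫ d = p n :=
      ⟨hK.desc (kellyCocone p hp'), hK.fac (kellyCocone p hp')⟩
    refine ⟨d, ?_, hu ▸ (hfac 0).trans hp₀⟩
    refine kelly_map_hom_ext hK fun n => ?_
    rw [reassoc_of% hs, ← T.map_comp_assoc, hfac, hfac, hp]
  hom_ext {B} r hr g h hg hh he := by
    subst hu
    refine kelly_hom_ext hK fun n => ?_
    induction n with
    | zero => exact he
    | succ n ih =>
      have := kellyC_epi (t := t) X n
      refine (cancel_epi (kellyC t X n)).1 ?_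
      rw [← reassoc_of% hs, ← reassoc_of% hs, hg, hh, ← T.map_comp_assoc, ih, T.map_comp_assoc]

/-- The clauses on the coprojections identify the structure `η ≫ μ` and the unit of `M` with those
of the free algebra on the colimit. -/
lemma isAlgebraicallyFree_of_isKellyColimit [PreservesColimitsOfShape ℕ T] {M : Monad C}
    {η : T ⟶ M.toFunctor} (h : t ≫ η = M.η) (hM : IsKellyColimit t M η) :
    IsAlgebraicallyFree t M η :=
  isAlgebraicallyFree_of_isFreePointedAlgebra h fun X => by
    obtain ⟨κ, ⟨hκ⟩, h0, hc⟩ := hM X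
    exact isFreePointedAlgebra_of_isColimit hκ (fun n => (hc n).symm) h0

end

noncomputable section

/-! ### Boxes and cells of a map -/

/-- The projection `X^⊔ ×_{Y^⊔} Y^(Iⁿ⁺¹) ⟶ X^⊔` at `f : X ⟶ Y`. -/
def boxProj (n : ℕ) (e : Bool) (f : Arrow CSet) :
    (squares n e).obj f ⟶ (ihom (box n e)).obj f.left :=
  (squaresFst n e).app f

/-- The projection `X^⊔ ×_{Y^⊔} Y^(Iⁿ⁺¹) ⟶ Y^(Iⁿ⁺¹)` at `f : X ⟶ Y`. -/
def cubeProj (n : ℕ) (e : Bool) (f : Arrow CSet) :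
    (squares n e).obj f ⟶ (ihom (II (n + 1))).obj f.right :=
  (squaresSnd n e).app f

/-- Evaluation `⊔ × S_{n,e}(f) ⟶ X`. -/
def boxEv (n : ℕ) (e : Bool) (f : Arrow CSet) : box n e ⊗ (squares n e).obj f ⟶ f.left :=
  (evalBox n e).app f

/-- Evaluation `Iⁿ⁺¹ × S_{n,e}(f) ⟶ Y`. -/
def cubeEv (n : ℕ) (e : Bool) (f : Arrow CSet) : II (n + 1) ⊗ (squares n e).obj f ⟶ f.right :=
  (evalCube n e).app f

/-- The map `X^(Iⁿ) ⟶ S_{n,e}(f)` of degenerate squares. -/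
def degenerateSquares (n : ℕ) (e : Bool) (f : Arrow CSet) :
    (ihom (II n)).obj f.left ⟶ (squares n e).obj f :=
  (degenerate n e).app f

lemma boxEv_naturality (n : ℕ) (e : Bool) {f g : Arrow CSet} (h : f ⟶ g) :
    box n e ◁ (squares n e).map h ≫ boxEv n e g = boxEv n e f ≫ h.left :=
  (evalBox n e).naturality h

lemma cubeEv_naturality (n : ℕ) (e : Bool) {f g : Arrow CSet} (h : f ⟶ g) :
    II (n + 1) ◁ (squares n e).map h ≫ cubeEv n e g = cubeEv n e f ≫ h.right :=
  (evalCube n e).naturality h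

lemma boxι_cubeEv (n : ℕ) (e : Bool) (f : Arrow CSet) :
    boxι n e ▷ (squares n e).obj f ≫ cubeEv n e f = boxEv n e f ≫ f.hom :=
  congr_app (box_condition n e) f

lemma boxEv_eq (n : ℕ) (e : Bool) (f : Arrow CSet) :
    boxEv n e f = MonoidalClosed.uncurry (boxProj n e f) :=
  (MonoidalClosed.uncurry_eq _).symm

lemma cubeEv_eq (n : ℕ) (e : Bool) (f : Arrow CSet) :
    cubeEv n e f = MonoidalClosed.uncurry (cubeProj n e f) :=
  (MonoidalClosed.uncurry_eq _).symm

lemma isPullback_squares (n : ℕ) (e : Bool) (f : Arrow CSet) :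
    IsPullback (boxProj n e f) (cubeProj n e f)
      ((ihom (box n e)).map f.hom) ((MonoidalClosed.pre (boxι n e)).app f.right) :=
  (IsPullback.of_hasPullback (Functor.whiskerRight Arrow.leftToRight (ihom (box n e)))
    (Functor.whiskerLeft Arrow.rightFunc (MonoidalClosed.pre (boxι n e)))).map
      ((evaluation _ _).obj f)

/-- With `exists_squares_lift`, this expresses that `S_{n,e}(f)` represents the squares from `⊔ × Z
⟶ Iⁿ⁺¹ × Z` to `f`: the two legs of the pullback are transposed. -/
lemma squares_hom_ext {n : ℕ} {e : Bool} {f : Arrow CSet} {Z : CSet}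
    {z z' : Z ⟶ (squares n e).obj f} (h₁ : box n e ◁ z ≫ boxEv n e f = box n e ◁ z' ≫ boxEv n e f)
    (h₂ : II (n + 1) ◁ z ≫ cubeEv n e f = II (n + 1) ◁ z' ≫ cubeEv n e f) : z = z' := by
  refine (isPullback_squares n e f).hom_ext (MonoidalClosed.uncurry_injective ?_)
    (MonoidalClosed.uncurry_injective ?_)
  · rw [MonoidalClosed.uncurry_natural_left, MonoidalClosed.uncurry_natural_left, ← boxEv_eq, h₁]
  · rw [MonoidalClosed.uncurry_natural_left, MonoidalClosed.uncurry_natural_left, ← cubeEv_eq, h₂]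

lemma exists_squares_lift {n : ℕ} {e : Bool} {f : Arrow CSet} {Z : CSet}
    (b : box n e ⊗ Z ⟶ f.left) (a : II (n + 1) ⊗ Z ⟶ f.right)
    (w : b ≫ f.hom = boxι n e ▷ Z ≫ a) :
    ∃ z : Z ⟶ (squares n e).obj f,
      box n e ◁ z ≫ boxEv n e f = b ∧ II (n + 1) ◁ z ≫ cubeEv n e f = a := by
  obtain ⟨z, h₁, h₂⟩ := (isPullback_squares n e f).exists_lift (MonoidalClosed.curry b)
    (MonoidalClosed.curry a) (by
      rw [← MonoidalClosed.curry_natural_right, MonoidalClosed.curry_pre_app, w])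
  refine ⟨z, ?_, ?_⟩
  · rw [boxEv_eq, ← MonoidalClosed.uncurry_natural_left]
    rw [h₁, MonoidalClosed.uncurry_curry]
  · rw [cubeEv_eq, ← MonoidalClosed.uncurry_natural_left]
    rw [h₂, MonoidalClosed.uncurry_curry]

lemma degenerateSquares_fst (n : ℕ) (e : Bool) (f : Arrow CSet) :
    degenerateSquares n e f ≫ boxProj n e f =
      (MonoidalClosed.pre (boxι n e ≫ proj n)).app f.left :=
  congr_app (pullback.lift_fst (f := Functor.whiskerRight Arrow.leftToRight (ihom (box n e)))
    (g := Functor.whiskerLeft Arrow.rightFunc (MonoidalClosed.pre (boxι n e))) _ _ _) f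

lemma degenerateSquares_boxEv (n : ℕ) (e : Bool) (f : Arrow CSet) :
    box n e ◁ degenerateSquares n e f ≫ boxEv n e f =
      (boxι n e ≫ proj n) ▷ _ ≫ (ihom.ev (II n)).app f.left := by
  rw [boxEv_eq, ← MonoidalClosed.uncurry_natural_left]
  exact (congrArg MonoidalClosed.uncurry (degenerateSquares_fst n e f)).trans
    (MonoidalClosed.uncurry_pre _ _)

/-- The map `eval ∘ (π × 1) : Iⁿ⁺¹ × X^(Iⁿ) ⟶ X`. -/
def degenerateEv (n : ℕ) (f : Arrow CSet) : II (n + 1) ⊗ (ihom (II n)).obj f.left ⟶ f.left :=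
  proj n ▷ _ ≫ (ihom.ev (II n)).app f.left

lemma degenerateSquares_cubeEv (n : ℕ) (e : Bool) (f : Arrow CSet) :
    II (n + 1) ◁ degenerateSquares n e f ≫ cubeEv n e f = degenerateEv n f ≫ f.hom :=
  congr_app (degenerate_condition n e) f

/-- The map `Ṫ f`. -/
def tDotArrow (f : Arrow CSet) : tDotObj.obj f ⟶ f.right := tDotHom.app f

/-- The inclusion `X ⟶ dom (Ṫ f)`. -/
def cellIncl (f : Arrow CSet) : f.left ⟶ tDotObj.obj f := tDotIncl.app f

/-- The functor `f ↦ ∐_{n,e} Iⁿ⁺¹ × S_{n,e}(f)`. -/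
abbrev sumTarget : Arrow CSet ⥤ CSet :=
  ∐ fun p : ℕ × Bool => squares p.1 p.2 ⋙ tensorLeft (II (p.1 + 1))

/-- The functor `f ↦ ∐_{n,e} (⊔ × S_{n,e}(f) + Iⁿ⁺¹ × X^(Iⁿ))`. -/
abbrev sumSource : Arrow CSet ⥤ CSet := ∐ fun p : ℕ × Bool => attachSource p.1 p.2

/-- The coprojections of `sumTarget`. -/
def sumTargetι (p : ℕ × Bool) : squares p.1 p.2 ⋙ tensorLeft (II (p.1 + 1)) ⟶ sumTarget :=
  Sigma.ι (fun p : ℕ × Bool => squares p.1 p.2 ⋙ tensorLeft (II (p.1 + 1))) p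

/-- The coprojections of `sumSource`. -/
def sumSourceι (p : ℕ × Bool) : attachSource p.1 p.2 ⟶ sumSource :=
  Sigma.ι (fun p : ℕ × Bool => attachSource p.1 p.2) p

/-- The coprojection `∐_{n,e} Iⁿ⁺¹ × S_{n,e}(f) ⟶ dom (Ṫ f)`. -/
def tDotCells : sumTarget ⟶ tDotObj := pushout.inl sumLeft sumTop

/-- The first coprojection of `attachSource`. -/
def attachInl (n : ℕ) (e : Bool) : squares n e ⋙ tensorLeft (box n e) ⟶ attachSource n e :=
  coprod.inl

/-- The second coprojection of `attachSource`. -/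
def attachInr (n : ℕ) (e : Bool) :
    (Arrow.leftFunc ⋙ ihom (II n)) ⋙ tensorLeft (II (n + 1)) ⟶ attachSource n e :=
  coprod.inr

lemma attachInl_left (n : ℕ) (e : Bool) : attachInl n e ≫ attachLeft n e =
    Functor.whiskerLeft (squares n e) ((curriedTensor CSet).map (boxι n e)) :=
  coprod.inl_desc _ _

lemma attachInr_left (n : ℕ) (e : Bool) : attachInr n e ≫ attachLeft n e =
    Functor.whiskerRight (degenerate n e) (tensorLeft (II (n + 1))) :=
  coprod.inr_desc _ _

lemma attachInl_top (n : ℕ) (e : Bool) : attachInl n e ≫ attachTop n e = evalBox n e :=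
  coprod.inl_desc _ _

lemma attachInr_top (n : ℕ) (e : Bool) : attachInr n e ≫ attachTop n e = evalDegenerate n :=
  coprod.inr_desc _ _

lemma sumSourceι_left (p : ℕ × Bool) :
    sumSourceι p ≫ sumLeft = attachLeft p.1 p.2 ≫ sumTargetι p :=
  Limits.ι_colimMap _ _

lemma sumSourceι_top (p : ℕ × Bool) : sumSourceι p ≫ sumTop = attachTop p.1 p.2 :=
  Sigma.ι_desc _ _

lemma isPushout_tDot : IsPushout sumLeft sumTop tDotCells tDotIncl :=
  IsPushout.of_hasPushout _ _

lemma tDotCells_hom (p : ℕ × Bool) :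
    sumTargetι p ≫ tDotCells ≫ tDotHom = evalCube p.1 p.2 :=
  (congrArg (sumTargetι p ≫ ·) (pushout.inl_desc (f := sumLeft) (g := sumTop) _ _ _)).trans
    (Sigma.ι_desc _ _)

/-- The coprojection `Iⁿ⁺¹ × S_{n,e}(f) ⟶ dom (Ṫ f)`. -/
def cell (n : ℕ) (e : Bool) (f : Arrow CSet) :
    II (n + 1) ⊗ (squares n e).obj f ⟶ tDotObj.obj f :=
  (sumTargetι (n, e) ≫ tDotCells).app f

lemma cell_naturality (n : ℕ) (e : Bool) {f g : Arrow CSet} (h : f ⟶ g) :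
    II (n + 1) ◁ (squares n e).map h ≫ cell n e g = cell n e f ≫ tDotObj.map h :=
  (sumTargetι (n, e) ≫ tDotCells).naturality h

lemma cellIncl_naturality {f g : Arrow CSet} (h : f ⟶ g) :
    h.left ≫ cellIncl g = cellIncl f ≫ tDotObj.map h :=
  tDotIncl.naturality h

lemma attachLeft_cell (n : ℕ) (e : Bool) :
    attachLeft n e ≫ sumTargetι (n, e) ≫ tDotCells = attachTop n e ≫ tDotIncl := by
  have h := congrArg (· ≫ tDotCells) (sumSourceι_left (n, e))
  dsimp only at h
  rw [Category.assoc, isPushout_tDot.w, ← Category.assoc, sumSourceι_top] at h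
  exact (h.trans (Category.assoc _ _ _)).symm

/-- The gluing relation from the first summand of the attaching source; `degenerateSquares_cell` is
the one from the second. An algebra turns them into the upper triangle and normality. -/
lemma boxι_cell (n : ℕ) (e : Bool) (f : Arrow CSet) :
    boxι n e ▷ _ ≫ cell n e f = boxEv n e f ≫ cellIncl f := by
  have h := congrArg (attachInl n e ≫ ·) (attachLeft_cell n e)
  rw [← Category.assoc, ← Category.assoc (attachInl n e), attachInl_left, attachInl_top] at h
  exact congr_app h f

lemma degenerateSquares_cell (n : ℕ) (e : Bool) (f : Arrow CSet) :
    II (n + 1) ◁ degenerateSquares n e f ≫ cell n e f = degenerateEv n f ≫ cellIncl f := by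
  have h := congrArg (attachInr n e ≫ ·) (attachLeft_cell n e)
  rw [← Category.assoc, ← Category.assoc (attachInr n e), attachInr_left, attachInr_top] at h
  exact congr_app h f

lemma cell_tDotArrow (n : ℕ) (e : Bool) (f : Arrow CSet) :
    cell n e f ≫ tDotArrow f = cubeEv n e f := by
  have h := tDotCells_hom (n, e)
  rw [← Category.assoc] at h
  exact congr_app h f

lemma cellIncl_tDotArrow (f : Arrow CSet) : cellIncl f ≫ tDotArrow f = f.hom :=
  tDotIncl_hom f

lemma isPushout_tDot_app (f : Arrow CSet) :
    IsPushout (sumLeft.app f) (sumTop.app f) (tDotCells.app f) (cellIncl f) :=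
  isPushout_tDot.map ((evaluation _ _).obj f)

lemma sumTarget_hom_ext {f : Arrow CSet} {W : CSet} {d d' : sumTarget.obj f ⟶ W}
    (h : ∀ p, (sumTargetι p).app f ≫ d = (sumTargetι p).app f ≫ d') : d = d' :=
  (isColimitOfPreserves ((evaluation _ _).obj f) (colimit.isColimit (Discrete.functor
    fun p : ℕ × Bool => squares p.1 p.2 ⋙ tensorLeft (II (p.1 + 1))))).hom_ext fun p => h p.as

lemma exists_sumTarget_desc {f : Arrow CSet} {W : CSet}
    (s : ∀ p : ℕ × Bool, II (p.1 + 1) ⊗ (squares p.1 p.2).obj f ⟶ W) :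
    ∃ d : sumTarget.obj f ⟶ W, ∀ p, (sumTargetι p).app f ≫ d = s p := by
  let hc := isColimitOfPreserves ((evaluation _ _).obj f) (colimit.isColimit (Discrete.functor
    fun p : ℕ × Bool => squares p.1 p.2 ⋙ tensorLeft (II (p.1 + 1))))
  exact ⟨hc.desc (Cocone.mk W (Discrete.natTrans fun p => s p.as)), fun p => hc.fac _ ⟨p⟩⟩

lemma sumSource_hom_ext {f : Arrow CSet} {W : CSet} {d d' : sumSource.obj f ⟶ W}
    (h : ∀ p, (sumSourceι p).app f ≫ d = (sumSourceι p).app f ≫ d') : d = d' :=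
  (isColimitOfPreserves ((evaluation _ _).obj f) (colimit.isColimit (Discrete.functor
    fun p : ℕ × Bool => attachSource p.1 p.2))).hom_ext fun p => h p.as

lemma attachSource_hom_ext {n : ℕ} {e : Bool} {f : Arrow CSet} {W : CSet}
    {d d' : (attachSource n e).obj f ⟶ W}
    (h₁ : (attachInl n e).app f ≫ d = (attachInl n e).app f ≫ d')
    (h₂ : (attachInr n e).app f ≫ d = (attachInr n e).app f ≫ d') : d = d' :=
  (isColimitOfPreserves ((evaluation _ _).obj f) (coprodIsCoprod (squares n e ⋙ tensorLeft (box n e))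
    ((Arrow.leftFunc ⋙ ihom (II n)) ⋙ tensorLeft (II (n + 1))))).hom_ext fun
      | ⟨.left⟩ => h₁
      | ⟨.right⟩ => h₂

lemma tDotObj_hom_ext {f : Arrow CSet} {W : CSet} {d d' : tDotObj.obj f ⟶ W}
    (h₁ : cellIncl f ≫ d = cellIncl f ≫ d') (h₂ : ∀ n e, cell n e f ≫ d = cell n e f ≫ d') :
    d = d' :=
  (isPushout_tDot_app f).hom_ext (sumTarget_hom_ext fun p => by
    rw [← Category.assoc, ← Category.assoc]; exact h₂ p.1 p.2) h₁

/-- The pushout and coproducts of functors are computed pointwise, so evaluation at `f` keeps their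
universal property. -/
lemma exists_tDotObj_desc {f : Arrow CSet} {W : CSet} (x : f.left ⟶ W)
    (s : ∀ n e, II (n + 1) ⊗ (squares n e).obj f ⟶ W)
    (h₁ : ∀ n e, boxι n e ▷ _ ≫ s n e = boxEv n e f ≫ x)
    (h₂ : ∀ n e, II (n + 1) ◁ degenerateSquares n e f ≫ s n e = degenerateEv n f ≫ x) :
    ∃ d : tDotObj.obj f ⟶ W, cellIncl f ≫ d = x ∧ ∀ n e, cell n e f ≫ d = s n e := by
  obtain ⟨d, hd⟩ := exists_sumTarget_desc (f := f) fun p => s p.1 p.2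
  obtain ⟨d', hd₁, hd₂⟩ := (isPushout_tDot_app f).exists_desc d x (by
    refine sumSource_hom_ext fun p => ?_
    have h3 := congrArg (· ≫ d) (congr_app (sumSourceι_left p) f)
    have h4 := congrArg (· ≫ x) (congr_app (sumSourceι_top p) f)
    rw [NatTrans.comp_app, NatTrans.comp_app] at h3
    rw [NatTrans.comp_app] at h4
    rw [Category.assoc, Category.assoc, hd] at h3
    refine h3.trans (Eq.trans ?_ (h4.symm.trans (Category.assoc _ _ _)))
    refine attachSource_hom_ext ?_ ?_
    · have h5 := congr_app (attachInl_left p.1 p.2) f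
      have h6 := congr_app (attachInl_top p.1 p.2) f
      rw [NatTrans.comp_app] at h5 h6
      exact (Category.assoc _ _ _).symm.trans ((congrArg (· ≫ s p.1 p.2) h5).trans
        ((h₁ p.1 p.2).trans (congrArg (· ≫ x) h6).symm |>.trans (Category.assoc _ _ _)))
    · have h5 := congr_app (attachInr_left p.1 p.2) f
      have h6 := congr_app (attachInr_top p.1 p.2) f
      rw [NatTrans.comp_app] at h5 h6
      exact (Category.assoc _ _ _).symm.trans ((congrArg (· ≫ s p.1 p.2) h5).trans
        ((h₂ p.1 p.2).trans (congrArg (· ≫ x) h6).symm |>.trans (Category.assoc _ _ _))))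
  refine ⟨d', hd₂, fun n e => ?_⟩
  have := hd (n, e)
  rw [← hd₁, ← Category.assoc] at this
  exact this

/-- Maps out of `A × S` are determined by their restrictions along maps from cubes to `S`. -/
lemma tensor_hom_ext_cubes {A S X : CSet} {s s' : A ⊗ S ⟶ X}
    (h : ∀ (k : ℕ) (z : II k ⟶ S), A ◁ z ≫ s = A ◁ z ≫ s') : s = s' := by
  -- After transposition the maps go out of `S`, where Yoneda applies.
  refine MonoidalClosed.curry_injective ?_
  refine NatTrans.ext (funext fun U => ?_)
  ext x
  have := congrArg MonoidalClosed.curry (h U.unop.unop (yonedaEquiv.symm x))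
  rw [MonoidalClosed.curry_natural_left, MonoidalClosed.curry_natural_left] at this
  have := congrArg yonedaEquiv this
  rw [yonedaEquiv_comp, yonedaEquiv_comp] at this
  simpa using this

/-- A family of maps `A × Iᵏ ⟶ X` indexed by the maps from cubes to `S` and natural in `Iᵏ` is
induced by a map `A × S ⟶ X`. -/
lemma exists_tensor_desc_cubes {A S X : CSet} (φ : ∀ k : ℕ, (II k ⟶ S) → (A ⊗ II k ⟶ X))
    (hφ : ∀ (j k : ℕ) (α : II j ⟶ II k) (z : II k ⟶ S), φ j (α ≫ z) = A ◁ α ≫ φ k z) :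
    ∃ s : A ⊗ S ⟶ X, ∀ (k : ℕ) (z : II k ⟶ S), A ◁ z ≫ s = φ k z := by
  -- An element of `S` is a map from a cube; it is sent to the transpose of its member of the
  -- family, and `hφ` is exactly naturality.
  let c : S ⟶ (ihom A).obj X :=
    { app U := ↾fun x => yonedaEquiv (MonoidalClosed.curry (φ U.unop.unop (yonedaEquiv.symm x)))
      naturality U V u := by
        ext x
        have h1 : yonedaEquiv.symm (S.map u x) = yoneda.map u.unop ≫ yonedaEquiv.symm x :=
          (yonedaEquiv_symm_map u x)
        have h2 := hφ _ _ (yoneda.map u.unop) (yonedaEquiv.symm x)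
        have h3 := congrArg (fun q => yonedaEquiv (MonoidalClosed.curry q)) h2
        rw [← h1, MonoidalClosed.curry_natural_left] at h3
        refine Eq.trans ?_ (h3.trans ?_)
        · rfl
        · exact (yonedaEquiv_naturality _ u.unop).symm }
  refine ⟨MonoidalClosed.uncurry c, fun k z => ?_⟩
  rw [← MonoidalClosed.uncurry_natural_left]
  refine (MonoidalClosed.curry_injective ?_)
  rw [MonoidalClosed.curry_uncurry]
  refine yonedaEquiv.injective ?_
  rw [yonedaEquiv_comp]
  change yonedaEquiv (MonoidalClosed.curry (φ k (yonedaEquiv.symm (yonedaEquiv z)))) = _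
  rw [Equiv.symm_apply_apply]

end

noncomputable section

/-! ### Algebras of `Ṫ` are normal uniform Kan fibrations -/

section

variable {n : ℕ} {e : Bool} {k : ℕ} {f : Arrow CSet}

/-- Filling problems have the parameter cube on the left, while evaluation has the exponent on the
left; the braiding mediates throughout. -/
lemma braid_boxι {k : ℕ} (n : ℕ) (e : Bool) :
    boxι n e ▷ II k ≫ (β_ (II (n + 1)) (II k)).hom =
      (β_ (box n e) (II k)).hom ≫ II k ◁ boxι n e :=
  BraidedCategory.braiding_naturality_left _ _

lemma braid_whiskerRight {A B Z : CSet} (α : A ⟶ B) :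
    α ▷ Z ≫ (β_ B Z).hom = (β_ A Z).hom ≫ Z ◁ α :=
  BraidedCategory.braiding_naturality_left _ _

lemma braid_whiskerLeft {A B Z : CSet} (α : A ⟶ B) :
    Z ◁ α ≫ (β_ Z B).hom = (β_ Z A).hom ≫ α ▷ Z :=
  BraidedCategory.braiding_naturality_right _ _

lemma braid_braid (A B : CSet) : (β_ A B).hom ≫ (β_ B A).hom = 𝟙 _ :=
  SymmetricCategory.symmetry _ _

/-- The classifying map `Iᵏ ⟶ S_{n,e}(f)` of a square from `Iᵏ × ⊔ ⟶ Iᵏ × Iⁿ⁺¹` to `f`. -/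
lemma exists_classifier (a : II k ⊗ II (n + 1) ⟶ f.right) (b : II k ⊗ box n e ⟶ f.left)
    (w : b ≫ f.hom = II k ◁ boxι n e ≫ a) :
    ∃ z : II k ⟶ (squares n e).obj f, box n e ◁ z ≫ boxEv n e f = (β_ _ _).hom ≫ b ∧
      II (n + 1) ◁ z ≫ cubeEv n e f = (β_ _ _).hom ≫ a :=
  exists_squares_lift _ _ (by
    rw [Category.assoc]
    erw [w]
    rw [← Category.assoc, ← Category.assoc, braid_boxι])

/-- The classifying map `Iᵏ ⟶ S_{n,e}(f)` of a square from `Iᵏ × ⊔ ⟶ Iᵏ × Iⁿ⁺¹` to `f`. -/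
def classifier (a : II k ⊗ II (n + 1) ⟶ f.right) (b : II k ⊗ box n e ⟶ f.left)
    (w : b ≫ f.hom = II k ◁ boxι n e ≫ a) : II k ⟶ (squares n e).obj f :=
  (exists_classifier a b w).choose

lemma classifier_boxEv (a : II k ⊗ II (n + 1) ⟶ f.right) (b : II k ⊗ box n e ⟶ f.left)
    (w : b ≫ f.hom = II k ◁ boxι n e ≫ a) :
    box n e ◁ classifier a b w ≫ boxEv n e f = (β_ _ _).hom ≫ b :=
  (exists_classifier a b w).choose_spec.1

lemma classifier_cubeEv (a : II k ⊗ II (n + 1) ⟶ f.right) (b : II k ⊗ box n e ⟶ f.left)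
    (w : b ≫ f.hom = II k ◁ boxι n e ≫ a) :
    II (n + 1) ◁ classifier a b w ≫ cubeEv n e f = (β_ _ _).hom ≫ a :=
  (exists_classifier a b w).choose_spec.2

/-- The upper map of the square classified by `z : Iᵏ ⟶ S_{n,e}(f)`. -/
def upper (z : II k ⟶ (squares n e).obj f) : II k ⊗ box n e ⟶ f.left :=
  (β_ _ _).hom ≫ box n e ◁ z ≫ boxEv n e f

/-- The lower map of the square classified by `z : Iᵏ ⟶ S_{n,e}(f)`. -/
def lower (z : II k ⟶ (squares n e).obj f) : II k ⊗ II (n + 1) ⟶ f.right :=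
  (β_ _ _).hom ≫ II (n + 1) ◁ z ≫ cubeEv n e f

lemma upper_lower (z : II k ⟶ (squares n e).obj f) :
    upper z ≫ f.hom = II k ◁ boxι n e ≫ lower z := by
  have h := boxι_cubeEv n e f
  have h' := braid_whiskerLeft (Z := II k) (boxι n e)
  rw [lower, reassoc_of% h', ← whisker_exchange_assoc, h, upper]
  simp only [Category.assoc]

lemma upper_classifier (a : II k ⊗ II (n + 1) ⟶ f.right) (b : II k ⊗ box n e ⟶ f.left)
    (w : b ≫ f.hom = II k ◁ boxι n e ≫ a) : upper (classifier a b w) = b := by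
  rw [upper, classifier_boxEv, ← Category.assoc, braid_braid, Category.id_comp]

lemma lower_classifier (a : II k ⊗ II (n + 1) ⟶ f.right) (b : II k ⊗ box n e ⟶ f.left)
    (w : b ≫ f.hom = II k ◁ boxι n e ≫ a) : lower (classifier a b w) = a := by
  rw [lower, classifier_cubeEv, ← Category.assoc, braid_braid, Category.id_comp]

lemma upper_lower_injective {z z' : II k ⟶ (squares n e).obj f} (h₁ : upper z = upper z')
    (h₂ : lower z = lower z') : z = z' :=
  squares_hom_ext ((cancel_epi (β_ (II k) (box n e)).hom).1 h₁)
    ((cancel_epi (β_ (II k) (II (n + 1))).hom).1 h₂)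

lemma upper_comp {j : ℕ} (α : II j ⟶ II k) (z : II k ⟶ (squares n e).obj f) :
    upper (α ≫ z) = α ▷ box n e ≫ upper z := by
  rw [upper, upper, reassoc_of% braid_whiskerRight α, MonoidalCategory.whiskerLeft_comp,
    Category.assoc]

lemma lower_comp {j : ℕ} (α : II j ⟶ II k) (z : II k ⟶ (squares n e).obj f) :
    lower (α ≫ z) = α ▷ II (n + 1) ≫ lower z := by
  rw [lower, lower, reassoc_of% braid_whiskerRight α, MonoidalCategory.whiskerLeft_comp,
    Category.assoc]

lemma upper_map {g : Arrow CSet} (h : f ⟶ g) (z : II k ⟶ (squares n e).obj f) :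
    upper (z ≫ (squares n e).map h) = upper z ≫ h.left := by
  rw [upper, upper, MonoidalCategory.whiskerLeft_comp, Category.assoc, boxEv_naturality]
  simp only [Category.assoc]

lemma lower_map {g : Arrow CSet} (h : f ⟶ g) (z : II k ⟶ (squares n e).obj f) :
    lower (z ≫ (squares n e).map h) = lower z ≫ h.right := by
  rw [lower, lower, MonoidalCategory.whiskerLeft_comp, Category.assoc, cubeEv_naturality]
  simp only [Category.assoc]

/-- The transpose of a map `Iᵏ × Iⁿ ⟶ X`. -/
def transpose {X : CSet} (c : II k ⊗ II n ⟶ X) : II k ⟶ (ihom (II n)).obj X :=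
  MonoidalClosed.curry ((β_ _ _).hom ≫ c)

lemma transpose_ev {X : CSet} (c : II k ⊗ II n ⟶ X) :
    II n ◁ transpose c ≫ (ihom.ev (II n)).app X = (β_ _ _).hom ≫ c :=
  MonoidalClosed.whiskerLeft_curry_ihom_ev_app _ _ _

lemma exists_transpose {X : CSet} (z : II k ⟶ (ihom (II n)).obj X) :
    ∃ c : II k ⊗ II n ⟶ X, transpose c = z :=
  ⟨(β_ _ _).hom ≫ MonoidalClosed.uncurry z, by
    rw [transpose, ← Category.assoc, braid_braid, Category.id_comp, MonoidalClosed.curry_uncurry]⟩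

lemma transpose_degenerateEv (c : II k ⊗ II n ⟶ f.left) :
    II (n + 1) ◁ transpose c ≫ degenerateEv n f = (β_ _ _).hom ≫ II k ◁ proj n ≫ c := by
  rw [degenerateEv, whisker_exchange_assoc, transpose_ev, ← Category.assoc, braid_whiskerRight,
    Category.assoc]

/-- With `lower_transpose`: the degenerate square at the transpose of `c` is the filling problem
that occurs in the normality condition. -/
lemma upper_transpose (e : Bool) (c : II k ⊗ II n ⟶ f.left) :
    upper (transpose c ≫ degenerateSquares n e f) = II k ◁ boxι n e ≫ II k ◁ proj n ≫ c := by
  rw [upper, MonoidalCategory.whiskerLeft_comp, Category.assoc, degenerateSquares_boxEv,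
    whisker_exchange_assoc, transpose_ev, ← Category.assoc (_ ▷ _), braid_whiskerRight,
    Category.assoc, ← Category.assoc, braid_braid, Category.id_comp,
    MonoidalCategory.whiskerLeft_comp, Category.assoc]

lemma lower_transpose (e : Bool) (c : II k ⊗ II n ⟶ f.left) :
    lower (transpose c ≫ degenerateSquares n e f) = II k ◁ proj n ≫ c ≫ f.hom := by
  rw [lower, MonoidalCategory.whiskerLeft_comp, Category.assoc, degenerateSquares_cubeEv,
    ← Category.assoc (_ ◁ transpose c), transpose_degenerateEv]
  simp only [← Category.assoc, braid_braid, Category.id_comp]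

end

/-- A retraction of the point `f ⟶ Ṫ f` over the codomain of `f`. -/
@[ext]
structure PointRetraction (f : Arrow CSet) where
  map : tDotObj.obj f ⟶ f.left
  incl_map : cellIncl f ≫ map = 𝟙 f.left
  map_hom : map ≫ f.hom = tDotArrow f

namespace PointRetraction

variable {f : Arrow CSet}

/-- The filler of the square classified by `z` that is determined by a retraction. -/
def filler (r : PointRetraction f) {n : ℕ} {e : Bool} {k : ℕ}
    (z : II k ⟶ (squares n e).obj f) : II k ⊗ II (n + 1) ⟶ f.left :=
  (β_ _ _).hom ≫ II (n + 1) ◁ z ≫ cell n e f ≫ r.map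

/-- The uniform Kan fibration structure determined by a retraction. -/
def toKan (r : PointRetraction f) : UniformKanStructure f.hom where
  fill n e k a b w := r.filler (classifier a b w)
  fill_upper n e k a b w := by
    have h := reassoc_of% boxι_cell n e f
    have h' := braid_whiskerLeft (Z := II k) (boxι n e)
    rw [filler, reassoc_of% h', ← whisker_exchange_assoc, h, r.incl_map, Category.comp_id]
    exact upper_classifier a b w
  fill_lower n e k a b w := by
    rw [filler, Category.assoc, Category.assoc, Category.assoc, r.map_hom, cell_tDotArrow]
    exact lower_classifier a b w
  fill_natural n e j k α a b w := by
    -- Uniformity is automatic: restricting a square along `α` precomposes its classifying map with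
    -- `α`.
    have h : classifier (α ▷ II (n + 1) ≫ a) (α ▷ box n e ≫ b)
        (by rw [Category.assoc, w, whisker_exchange_assoc]) = α ≫ classifier a b w :=
      upper_lower_injective (by rw [upper_comp, upper_classifier, upper_classifier])
        (by rw [lower_comp, lower_classifier, lower_classifier])
    rw [h, filler, filler, reassoc_of% braid_whiskerRight α, MonoidalCategory.whiskerLeft_comp,
      Category.assoc]

lemma toKan_normal (r : PointRetraction f) : r.toKan.IsNormal := by
  intro n e k c
  have h : classifier (II k ◁ proj n ≫ c ≫ f.hom) (II k ◁ boxι n e ≫ II k ◁ proj n ≫ c)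
      (by simp) = transpose c ≫ degenerateSquares n e f :=
    upper_lower_injective (by rw [upper_classifier, upper_transpose])
      (by rw [lower_classifier, lower_transpose])
  change r.filler (classifier _ _ _) = _
  rw [h, filler, MonoidalCategory.whiskerLeft_comp, Category.assoc,
    reassoc_of% degenerateSquares_cell n e f, r.incl_map, Category.comp_id,
    transpose_degenerateEv, ← Category.assoc, braid_braid, Category.id_comp]

/-- Uniformity makes the fillers a natural family indexed by maps `Iᵏ ⟶ S_{n,e}(f)`, hence a single
map on each cell. The upper triangle and normality are the two gluing equations; the lower triangle
puts the result over the codomain. -/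
lemma exists_ofKan (φ : UniformKanStructure f.hom) (hφ : φ.IsNormal) :
    ∃ r : PointRetraction f, r.toKan = φ := by
  have hs (n : ℕ) (e : Bool) := exists_tensor_desc_cubes (A := II (n + 1))
    (S := (squares n e).obj f) (X := f.left)
    (fun k z => (β_ _ _).hom ≫ φ.fill n e k (lower z) (upper z) (upper_lower z))
    (fun j k α z => by
      simp only [upper_comp, lower_comp]
      rw [← φ.fill_natural n e j k α _ _ (upper_lower z), ← Category.assoc, ← Category.assoc,
        braid_whiskerLeft])
  choose s hs using hs
  obtain ⟨d, hd₁, hd₂⟩ := exists_tDotObj_desc (𝟙 f.left) s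
    (fun n e => tensor_hom_ext_cubes fun k z => by
      rw [whisker_exchange_assoc, hs, ← Category.assoc, braid_boxι, Category.assoc, φ.fill_upper,
        upper, ← Category.assoc, braid_braid, Category.id_comp, Category.comp_id])
    (fun n e => tensor_hom_ext_cubes fun k z => by
      -- Every map from a cube to `X^(Iⁿ)` is a transpose, so normality covers all degenerate
      -- squares.
      obtain ⟨c, rfl⟩ := exists_transpose z
      rw [← MonoidalCategory.whiskerLeft_comp_assoc, hs, Category.comp_id, transpose_degenerateEv]
      simp only [upper_transpose, lower_transpose]
      rw [hφ n e k c])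
  let r : PointRetraction f := ⟨d, hd₁, tDotObj_hom_ext
    (by rw [← Category.assoc, hd₁, cellIncl_tDotArrow, Category.id_comp])
    (fun n e => by
      rw [← Category.assoc, hd₂, cell_tDotArrow]
      refine tensor_hom_ext_cubes fun k z => ?_
      rw [← Category.assoc, hs, Category.assoc, φ.fill_lower, lower, ← Category.assoc, braid_braid,
        Category.id_comp])⟩
  refine ⟨r, ?_⟩
  have : r.toKan.fill = φ.fill := by
    funext n e k a b w
    change (β_ _ _).hom ≫ II (n + 1) ◁ classifier a b w ≫ cell n e f ≫ d = _
    rw [hd₂, hs, ← Category.assoc, braid_braid, Category.id_comp]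
    simp only [upper_classifier, lower_classifier]
  cases φ
  cases h : r.toKan
  rw [h] at this
  cases this
  rfl

/-- Two maps out of `dom (Ṫ f)` are compared. On `X` they agree by the retraction laws; on cells the
comparison can be tested along maps `Iᵏ ⟶ S_{n,e}(f)`, that is, on filling problems. -/
lemma map_comm_iff {g : Arrow CSet} (r : PointRetraction f) (r' : PointRetraction g) (h : f ⟶ g) :
    tDotObj.map h ≫ r'.map = r.map ≫ h.left ↔
    ∀ (n : ℕ) (e : Bool) (k : ℕ) (a : II k ⊗ II (n + 1) ⟶ f.right)
    (b : II k ⊗ box n e ⟶ f.left) (w : b ≫ f.hom = II k ◁ boxι n e ≫ a),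
    r.toKan.fill n e k a b w ≫ h.left =
      r'.toKan.fill n e k (a ≫ h.right) (b ≫ h.left)
        (by rw [Category.assoc, Arrow.w h, reassoc_of% w]) := by
  have hc (n : ℕ) (e : Bool) (k : ℕ) (a : II k ⊗ II (n + 1) ⟶ f.right)
      (b : II k ⊗ box n e ⟶ f.left) (w : b ≫ f.hom = II k ◁ boxι n e ≫ a) :
      classifier (a ≫ h.right) (b ≫ h.left) (by rw [Category.assoc, Arrow.w h, reassoc_of% w]) =
        classifier a b w ≫ (squares n e).map h :=
    upper_lower_injective (by rw [upper_map, upper_classifier, upper_classifier])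
      (by rw [lower_map, lower_classifier, lower_classifier])
  constructor
  · intro H n e k a b w
    change r.filler _ ≫ _ = r'.filler _
    rw [hc, filler, filler, MonoidalCategory.whiskerLeft_comp]
    simp only [Category.assoc]
    rw [← H, reassoc_of% cell_naturality n e h]
  · intro H
    refine tDotObj_hom_ext ?_ fun n e => tensor_hom_ext_cubes fun k z => ?_
    · rw [← Category.assoc, ← cellIncl_naturality, Category.assoc, r'.incl_map, ← Category.assoc,
        r.incl_map, Category.id_comp, Category.comp_id]
    · have H' := H n e k (lower z) (upper z) (upper_lower z)
      have hz : classifier (lower z) (upper z) (upper_lower z) = z :=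
        upper_lower_injective (upper_classifier _ _ _) (lower_classifier _ _ _)
      change r.filler _ ≫ _ = r'.filler _ at H'
      rw [hc _ _ _ _ _ (upper_lower z), hz, filler, filler, MonoidalCategory.whiskerLeft_comp] at H'
      simp only [Category.assoc] at H'
      have H'' := (cancel_epi (β_ (II k) (II (n + 1))).hom).1 H'
      rw [reassoc_of% cell_naturality n e h] at H''
      exact H''.symm

/-- If the fillers coincide, the identity square preserves them and is therefore a map of algebras.
-/
lemma toKan_injective {r r' : PointRetraction f} (h : r.toKan = r'.toKan) : r = r' := by
  have := (map_comm_iff r r' (𝟙 f)).2 (by intros; simp [h])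
  ext1
  simpa using this.symm

lemma algebra_right {f : Arrow CSet} (s : tDot.obj f ⟶ f) (h : tDotPoint.app f ≫ s = 𝟙 f) :
    s.right = 𝟙 f.right :=
  (Category.id_comp (X := f.right) (Y := f.right) s.right).symm.trans
    (congrArg CommaMorphism.right h)

/-- The retraction given by an algebra of `(Ṫ, ṫ)`. -/
def ofAlgebra {f : Arrow CSet} (s : tDot.obj f ⟶ f) (h : tDotPoint.app f ≫ s = 𝟙 f) :
    PointRetraction f where
  map := s.left
  incl_map := congrArg CommaMorphism.left h
  map_hom := by
    have h₂ : s.left ≫ f.hom = tDotArrow f ≫ s.right := s.w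
    exact h₂.trans ((congrArg (tDotArrow f ≫ ·) (algebra_right s h)).trans
      (Category.comp_id (tDotArrow f)))

/-- The algebra of `(Ṫ, ṫ)` given by a retraction. -/
def algebra (r : PointRetraction f) : tDot.obj f ⟶ f :=
  Arrow.homMk r.map (𝟙 f.right) (r.map_hom.trans (Category.comp_id _).symm)

lemma point_algebra (r : PointRetraction f) : tDotPoint.app f ≫ r.algebra = 𝟙 f := by
  ext1
  · exact r.incl_map
  · exact Category.comp_id (𝟙 f.right)

lemma ofAlgebra_algebra (r : PointRetraction f) : ofAlgebra r.algebra r.point_algebra = r := rfl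

lemma algebra_ofAlgebra (s : tDot.obj f ⟶ f) (h : tDotPoint.app f ≫ s = 𝟙 f) :
    (ofAlgebra s h).algebra = s := by
  ext1
  · rfl
  · exact (algebra_right s h).symm

lemma algebra_comm_iff {g : Arrow CSet} (r : PointRetraction f) (r' : PointRetraction g)
    (h : f ⟶ g) : tDot.map h ≫ r'.algebra = r.algebra ≫ h ↔
      tDotObj.map h ≫ r'.map = r.map ≫ h.left := by
  constructor
  · exact fun H => congrArg CommaMorphism.left H
  · intro H
    ext1
    · exact H
    · exact (Category.comp_id h.right).trans (Category.id_comp h.right).symm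

end PointRetraction

/-- The retraction that corresponds to a normal uniform Kan fibration structure. -/
def NormalKanFibration.retraction (F : NormalKanFibration) : PointRetraction F.arrow :=
  (PointRetraction.exists_ofKan F.str F.normal).choose

lemma NormalKanFibration.toKan_retraction (F : NormalKanFibration) : F.retraction.toKan = F.str :=
  (PointRetraction.exists_ofKan F.str F.normal).choose_spec

/-- The retraction given by an algebra of `(Ṫ, ṫ)`. -/
def pointedAlgebraRetraction (A : PointedAlgebra tDotPoint) : PointRetraction A.obj.a :=
  PointRetraction.ofAlgebra A.obj.str A.property

lemma algebra_pointedAlgebraRetraction (A : PointedAlgebra tDotPoint) :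
    (pointedAlgebraRetraction A).algebra = A.obj.str :=
  PointRetraction.algebra_ofAlgebra _ _

/-- Algebras of `(Ṫ, ṫ)` are normal uniform Kan fibrations. -/
def algebraToKan : PointedAlgebra tDotPoint ⥤ NormalKanFibration where
  obj A := ⟨A.obj.a, (pointedAlgebraRetraction A).toKan, PointRetraction.toKan_normal _⟩
  map {A B} g := ⟨g.hom.f, (PointRetraction.map_comm_iff _ _ _).1
    ((PointRetraction.algebra_comm_iff _ _ _).1 (by
      rw [algebra_pointedAlgebraRetraction, algebra_pointedAlgebraRetraction]
      exact g.hom.h))⟩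

/-- Normal uniform Kan fibrations are algebras of `(Ṫ, ṫ)`. -/
def kanToAlgebra : NormalKanFibration ⥤ PointedAlgebra tDotPoint where
  obj F := ⟨⟨F.arrow, F.retraction.algebra⟩, F.retraction.point_algebra⟩
  map {F G} h := ObjectProperty.homMk ⟨h.hom, (PointRetraction.algebra_comm_iff _ _ _).2
    ((PointRetraction.map_comm_iff _ _ _).2 (by
      rw [F.toKan_retraction, G.toKan_retraction]
      exact h.map_fill))⟩

instance : NormalKanFibration.forget.Faithful where
  map_injective h := NormalKanFibration.Hom.ext h

lemma isIsoOfCategories_algebraToKan : IsIsoOfCategories algebraToKan :=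
  isIsoOfCategories_of_comp_faithful (PointedAlgebra.forget tDotPoint) NormalKanFibration.forget
    algebraToKan kanToAlgebra rfl rfl
    (by
      rintro ⟨⟨f, s⟩, h⟩
      have : (algebraToKan.obj ⟨⟨f, s⟩, h⟩).retraction = PointRetraction.ofAlgebra s h :=
        PointRetraction.toKan_injective (NormalKanFibration.toKan_retraction _)
      have h' : (algebraToKan.obj ⟨⟨f, s⟩, h⟩).retraction.algebra = s :=
        (congrArg _ this).trans (PointRetraction.algebra_ofAlgebra s h)
      simp only [kanToAlgebra]
      congr 2)
    (by
      intro F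
      have h : pointedAlgebraRetraction (kanToAlgebra.obj F) = F.retraction :=
        F.retraction.ofAlgebra_algebra
      have h' : (pointedAlgebraRetraction (kanToAlgebra.obj F)).toKan = F.str :=
        (congrArg _ h).trans F.toKan_retraction
      obtain ⟨f, φ, hφ⟩ := F
      simp only [algebraToKan]
      congr 1)

end

noncomputable section

/-! ### `Ṫ` preserves colimits of sequences -/

/-! ### Closure of sequential continuity under colimits and pullbacks -/

section Closure

universe v₁ u₁ v₂ u₂ v₃ u₃ v₄ u₄

/-- Colimits commute with colimits: `colimit D` is the flip of `D` followed by the colimit functor.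
-/
lemma preservesColimitsOfShape_colimit {J : Type u₁} [Category.{v₁} J] {K : Type u₂}
    [Category.{v₂} K] {A : Type u₃} [Category.{v₃} A] {C : Type u₄} [Category.{v₄} C]
    [HasColimitsOfShape K C] (D : K ⥤ A ⥤ C)
    [∀ k, PreservesColimitsOfShape J (D.obj k)] : PreservesColimitsOfShape J (colimit D) := by
  have : PreservesColimitsOfShape J D.flip :=
    preservesColimitsOfShape_of_evaluation _ _ fun k =>
      inferInstanceAs (PreservesColimitsOfShape J (D.obj k))
  exact preservesColimitsOfShape_of_natIso (colimitIsoFlipCompColim D).symm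

variable {A : Type u₁} [Category.{v₁} A]

/-- The filter form lets finitely many such conditions be met at one common stage. -/
lemma exists_stage {F : ℕ ⥤ A} {c : Cocone F} (hc : IsColimit c) (G : A ⥤ Type)
    [PreservesColimitsOfShape ℕ G] (x : G.obj c.pt) :
    ∀ᶠ i in Filter.atTop, ∃ y : G.obj (F.obj i), G.map (c.ι.app i) y = x := by
  obtain ⟨j, y, hy⟩ := Types.jointly_surjective_of_isColimit (isColimitOfPreserves G hc) x
  refine Filter.eventually_atTop.2 ⟨j, fun i hi => ⟨G.map (F.map (homOfLE hi)) y, ?_⟩⟩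
  rw [← Functor.map_comp_apply, c.w]
  exact hy

lemma eventually_eq_of_colimit {F : ℕ ⥤ A} {c : Cocone F} (hc : IsColimit c) (G : A ⥤ Type)
    [PreservesColimitsOfShape ℕ G] {i : ℕ} (x y : G.obj (F.obj i))
    (h : G.map (c.ι.app i) x = G.map (c.ι.app i) y) :
    ∀ᶠ j in Filter.atTop, ∀ hj : i ≤ j,
      G.map (F.map (homOfLE hj)) x = G.map (F.map (homOfLE hj)) y := by
  obtain ⟨k, f, hk⟩ := (Types.FilteredColimit.isColimit_eq_iff' (isColimitOfPreserves G hc) x y).1 h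
  refine Filter.eventually_atTop.2 ⟨k, fun j hkj hij => ?_⟩
  have : homOfLE hij = f ≫ homOfLE hkj := Subsingleton.elim _ _
  rw [this, F.map_comp, Functor.map_comp_apply, Functor.map_comp_apply]
  exact congrArg _ hk

/-- A functor to sets preserves colimits of sequences if it does so on elements. -/
lemma preservesColimitsOfShape_nat_of_elements (G : A ⥤ Type)
    (hsurj : ∀ {F : ℕ ⥤ A} {c : Cocone F}, IsColimit c → ∀ x : G.obj c.pt,
      ∃ i, ∃ y : G.obj (F.obj i), G.map (c.ι.app i) y = x)
    (hinj : ∀ {F : ℕ ⥤ A} {c : Cocone F}, IsColimit c → ∀ {i : ℕ} (x y : G.obj (F.obj i)),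
      G.map (c.ι.app i) x = G.map (c.ι.app i) y →
      ∃ j, ∃ hj : i ≤ j, G.map (F.map (homOfLE hj)) x = G.map (F.map (homOfLE hj)) y) :
    PreservesColimitsOfShape ℕ G where
  preservesColimit {F} := ⟨fun {c} hc => ⟨Types.FilteredColimit.isColimitOf' _ _
    (fun x => by
      obtain ⟨i, y, h⟩ := hsurj hc x
      exact ⟨i, y, h.symm⟩)
    (fun i x y h => by
      obtain ⟨j, hj, h'⟩ := hinj hc x y h
      exact ⟨j, homOfLE hj, h'⟩)⟩⟩

/-- Filtered colimits commute with finite limits in sets: both components of an element lift to a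
finite stage, and their images in `F₃` agree at a later one. -/
lemma preservesColimitsOfShape_nat_of_isPullback {P F₁ F₂ F₃ : A ⥤ Type} {p : P ⟶ F₁} {q : P ⟶ F₂}
    {f : F₁ ⟶ F₃} {g : F₂ ⟶ F₃} (h : IsPullback p q f g) [PreservesColimitsOfShape ℕ F₁]
    [PreservesColimitsOfShape ℕ F₂] [PreservesColimitsOfShape ℕ F₃] :
    PreservesColimitsOfShape ℕ P := by
  have hP (X : A) : IsPullback (p.app X) (q.app X) (f.app X) (g.app X) :=
    h.map ((evaluation _ _).obj X)
  have hw (X : A) (z : P.obj X) : f.app X (p.app X z) = g.app X (q.app X z) :=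
    ConcreteCategory.congr_hom (hP X).w z
  have hlift (X : A) (x : F₁.obj X) (y : F₂.obj X) (hxy : f.app X x = g.app X y) :
      ∃ z : P.obj X, p.app X z = x ∧ q.app X z = y :=
    (Types.exists_of_isPullback (hP X) x y hxy)
  have hext (X : A) (z z' : P.obj X) (h₁ : p.app X z = p.app X z') (h₂ : q.app X z = q.app X z') :
      z = z' := Types.ext_of_isPullback (hP X) h₁ h₂
  refine preservesColimitsOfShape_nat_of_elements P ?_ ?_
  · intro F c hc x
    obtain ⟨i, ⟨y₁, h₁⟩, ⟨y₂, h₂⟩⟩ :=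
      ((exists_stage hc F₁ (p.app _ x)).and (exists_stage hc F₂ (q.app _ x))).exists
    obtain ⟨j, hj, hij⟩ := ((eventually_eq_of_colimit hc F₃ (f.app _ y₁) (g.app _ y₂) (by
      rw [← NatTrans.naturality_apply, ← NatTrans.naturality_apply, h₁, h₂]
      exact hw c.pt x)).and
        (Filter.eventually_ge_atTop i)).exists
    have hj := hj hij
    rw [← NatTrans.naturality_apply, ← NatTrans.naturality_apply] at hj
    obtain ⟨z, hz₁, hz₂⟩ := hlift _ _ _ hj
    refine ⟨j, z, hext _ _ _ ?_ ?_⟩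
    · rw [NatTrans.naturality_apply, hz₁, ← Functor.map_comp_apply, c.w, h₁]
      rfl
    · rw [NatTrans.naturality_apply, hz₂, ← Functor.map_comp_apply, c.w, h₂]
      rfl
  · intro F c hc i x y hxy
    obtain ⟨j, ⟨h₁, h₂⟩, hij⟩ := (((eventually_eq_of_colimit hc F₁ (p.app _ x) (p.app _ y) (by
      rw [← NatTrans.naturality_apply, ← NatTrans.naturality_apply, hxy])).and
      (eventually_eq_of_colimit hc F₂ (q.app _ x) (q.app _ y) (by
      rw [← NatTrans.naturality_apply, ← NatTrans.naturality_apply, hxy]))).and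
        (Filter.eventually_ge_atTop i)).exists
    have h₁ := h₁ hij
    have h₂ := h₂ hij
    rw [← NatTrans.naturality_apply, ← NatTrans.naturality_apply] at h₁ h₂
    exact ⟨j, hij, hext _ _ _ h₁ h₂⟩

end Closure

/-! ### Maps of finite bipointed sets and finite cubical sets -/

lemma bip_hom_ext {m n : ℕ} {f g : bip m ⟶ bip n}
    (h : ∀ i : Fin m, f.hom.toFun (bipVar i) = g.hom.toFun (bipVar i)) : f = g := by
  refine InducedCategory.hom_ext (Bipointed.Hom.ext (funext fun x => ?_))
  induction x using WithBot.recBotCoe with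
  | bot => exact f.hom.map_fst.trans g.hom.map_fst.symm
  | coe x =>
    induction x using WithTop.recTopCoe with
    | top => exact f.hom.map_snd.trans g.hom.map_snd.symm
    | coe i => exact h i

lemma bipHom_var {m n : ℕ} (g : Fin m → bracket n) (i : Fin m) :
    (bipHom g).hom.toFun (bipVar i) = g i := rfl

lemma bip_cases {n : ℕ} (x : bracket n) : (∃ d, x = bipPoint d) ∨ ∃ i, x = bipVar i := by
  induction x using WithBot.recBotCoe with
  | bot => exact Or.inl ⟨false, rfl⟩
  | coe x =>
    induction x using WithTop.recTopCoe with
    | top => exact Or.inl ⟨true, rfl⟩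
    | coe i => exact Or.inr ⟨i, rfl⟩

lemma bip_hom_point {m n : ℕ} (f : bip m ⟶ bip n) (d : Bool) :
    f.hom.toFun (bipPoint d) = bipPoint d := by
  cases d
  · exact f.hom.map_fst
  · exact f.hom.map_snd

instance (m n : ℕ) : Finite (bip m ⟶ bip n) := by
  have : Finite (bracket n) := inferInstanceAs (Finite (WithBot (WithTop (Fin n))))
  exact Finite.of_injective (fun f (i : Fin m) => f.hom.toFun (bipVar i)) fun f g h =>
    bip_hom_ext (congrFun h)

lemma bipVar_injective (n : ℕ) : Function.Injective (bipVar (n := n)) := fun _ _ h =>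
  WithTop.coe_injective (WithBot.coe_injective h)

/-- Every map in `𝔹` factors through a split subobject that is no larger than its domain. -/
lemma exists_bip_image {N m : ℕ} (u : bip N ⟶ bip m) : ∃ t ≤ N, ∃ (k : bip t ⟶ bip m)
    (l : bip m ⟶ bip t), k ≫ l = 𝟙 _ ∧ u ≫ l ≫ k = u := by
  classical
  let R : Finset (Fin m) := Finset.univ.filter fun i => ∃ j, u.hom.toFun (bipVar j) = bipVar i
  have hR : R.card ≤ N := by
    have hex (i : R) : ∃ j, u.hom.toFun (bipVar j) = bipVar i.1 := (Finset.mem_filter.1 i.2).2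
    choose g hg using hex
    have hinj : Function.Injective g := fun i i' h =>
      Subtype.ext (bipVar_injective m ((hg i).symm.trans ((congrArg _ (congrArg _ h)).trans (hg i'))))
    simpa using Fintype.card_le_of_injective g hinj
  let e := R.equivFin
  let k : bip R.card ⟶ bip m := bipHom fun i => bipVar (e.symm i).1
  let l : bip m ⟶ bip R.card :=
    -- Variables outside the image of `u` may go anywhere; `⊥` is an arbitrary choice.
    bipHom fun i => if h : i ∈ R then bipVar (e ⟨i, h⟩) else bipPoint false
  refine ⟨R.card, hR, k, l, bip_hom_ext fun i => ?_, bip_hom_ext fun i => ?_⟩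
  · change l.hom.toFun (bipVar _) = _
    rw [bipHom_var, dif_pos (e.symm i).2]
    exact congrArg bipVar (e.apply_symm_apply i)
  · change k.hom.toFun (l.hom.toFun (u.hom.toFun (bipVar i))) = _
    obtain ⟨d, hd⟩ | ⟨j, hj⟩ := bip_cases (u.hom.toFun (bipVar i))
    · rw [hd, bip_hom_point, bip_hom_point]
    · have hjR : j ∈ R := Finset.mem_filter.2 ⟨Finset.mem_univ _, i, hj⟩
      rw [hj, bipHom_var, dif_pos hjR, bipHom_var, e.symm_apply_apply]

/-- Any two maps in `𝔹` with the same codomain factor through a common split subobject whose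
size is bounded by the sizes of the domains. -/
lemma exists_bip_joint_image {r s m : ℕ} (u : bip r ⟶ bip m) (v : bip s ⟶ bip m) :
    ∃ t ≤ r + s, ∃ (k : bip t ⟶ bip m) (l : bip m ⟶ bip t),
      k ≫ l = 𝟙 _ ∧ u ≫ l ≫ k = u ∧ v ≫ l ≫ k = v := by
  -- `[r + s]` is the coproduct of `[r]` and `[s]` in `𝔹`, so the image of the copairing serves both
  -- maps.
  let w : bip (r + s) ⟶ bip m := bipHom (Fin.append (fun i => u.hom.toFun (bipVar i))
    fun i => v.hom.toFun (bipVar i))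
  let i₁ : bip r ⟶ bip (r + s) := bipHom fun i => bipVar (Fin.castAdd s i)
  let i₂ : bip s ⟶ bip (r + s) := bipHom fun i => bipVar (Fin.natAdd r i)
  have h₁ : i₁ ≫ w = u := bip_hom_ext fun i =>
    Fin.append_left (fun i => u.hom.toFun (bipVar i)) (fun i => v.hom.toFun (bipVar i)) i
  have h₂ : i₂ ≫ w = v := bip_hom_ext fun i =>
    Fin.append_right (fun i => u.hom.toFun (bipVar i)) (fun i => v.hom.toFun (bipVar i)) i
  obtain ⟨t, ht, k, l, hkl, hw⟩ := exists_bip_image w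
  refine ⟨t, ht, k, l, hkl, ?_, ?_⟩
  · rw [← h₁, Category.assoc, hw]
  · rw [← h₂, Category.assoc, hw]

/-- A cubical set is finite of dimension at most `d` if its sets of cubes are finite and all its
cubes are degeneracies of cubes of dimension at most `d`. -/
structure IsFiniteOfDim (Q : CSet) (d : ℕ) : Prop where
  finite : ∀ m, Finite (Q.obj (.op (cube m)))
  exists_degeneracy : ∀ m (x : Q.obj (.op (cube m))), ∃ r ≤ d, ∃ (u : bip r ⟶ bip m)
    (y : Q.obj (.op (cube r))), Q.map u.op.op y = x

namespace IsFiniteOfDim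

variable {Q : CSet} {d : ℕ}

lemma hom_ext (hQ : IsFiniteOfDim Q d) {Y : CSet} {g g' : Q ⟶ Y}
    (h : ∀ r ≤ d, ∀ x : Q.obj (.op (cube r)), g.app _ x = g'.app _ x) : g = g' := by
  ext U x
  obtain ⟨r, hr, u, y, rfl⟩ := hQ.exists_degeneracy U.unop.unop x
  have := congrArg (Y.map u.op.op) (h r hr y)
  rw [← NatTrans.naturality_apply, ← NatTrans.naturality_apply] at this
  exact this

/-- Values on cubes of dimension at most `d` determine the map. For it to be well defined, two
presentations of one cube must be compared, and this can be done in a common split subobject of size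
at most `d + d`; hence the doubled bound. -/
lemma exists_extension (hQ : IsFiniteOfDim Q d) {Y : CSet}
    (h : ∀ r, r ≤ d + d → Q.obj (.op (cube r)) → Y.obj (.op (cube r)))
    (hnat : ∀ r hr s hs, ∀ (u : bip r ⟶ bip s) (x : Q.obj (.op (cube r))),
      h s hs (Q.map u.op.op x) = Y.map u.op.op (h r hr x)) :
    ∃ g : Q ⟶ Y, ∀ r (hr : r ≤ d), ∀ x : Q.obj (.op (cube r)), g.app _ x = h r (by lia) x := by
  have key {r s m : ℕ} (hr : r ≤ d) (hs : s ≤ d) (u : bip r ⟶ bip m) (v : bip s ⟶ bip m)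
      (y : Q.obj (.op (cube r))) (z : Q.obj (.op (cube s)))
      (hyz : Q.map u.op.op y = Q.map v.op.op z) :
      Y.map u.op.op (h r (by lia) y) = Y.map v.op.op (h s (by lia) z) := by
    -- Applying `l` moves the equality to dimension `t`, where naturality of `h` is available; `k`
    -- brings it back.
    obtain ⟨t, ht, k, l, -, hu, hv⟩ := exists_bip_joint_image u v
    have h₁ := hnat r (by lia) t (by lia) (u ≫ l) y
    have h₂ := hnat s (by lia) t (by lia) (v ≫ l) z
    have h₃ : Q.map (u ≫ l).op.op y = Q.map (v ≫ l).op.op z := by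
      have := congrArg (Q.map l.op.op) hyz
      rw [← Functor.map_comp_apply, ← Functor.map_comp_apply] at this
      exact this
    rw [h₃, h₂] at h₁
    have h₄ := congrArg (Y.map k.op.op) h₁
    rw [← Functor.map_comp_apply, ← Functor.map_comp_apply, ← op_comp, ← op_comp, ← op_comp,
      ← op_comp, Category.assoc, Category.assoc, hu, hv] at h₄
    exact h₄.symm
  choose r hr u y hy using hQ.exists_degeneracy
  let g : Q ⟶ Y :=
    { app U := ↾fun x => Y.map (u U.unop.unop x).op.op
        (h _ ((hr U.unop.unop x).trans (d.le_add_left d)) (y U.unop.unop x))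
      naturality U V w := by
        ext x
        have h₁ := key (hr V.unop.unop (Q.map w x)) (hr U.unop.unop x) (u _ (Q.map w x))
          (u U.unop.unop x ≫ w.unop.unop) (y _ (Q.map w x)) (y U.unop.unop x) (by
            rw [hy, op_comp, op_comp, Functor.map_comp_apply, hy]; rfl)
        rw [op_comp, op_comp, Functor.map_comp_apply] at h₁
        exact h₁ }
  refine ⟨g, fun s hs x => ?_⟩
  have h₁ := key (hr s x) hs (u s x) (𝟙 _) (y s x) x (by rw [hy]; simp)
  refine Eq.trans h₁ ?_
  simp

/-- In dimensions up to `d + d` there are finitely many cubes of `Q` and finitely many maps of `𝔹`.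
So the values of a map to the colimit lift to one stage, and the naturality equations hold at a
later one. -/
lemma preservesColimitsOfShape_coyoneda (hQ : IsFiniteOfDim Q d) :
    PreservesColimitsOfShape ℕ (coyoneda.obj (.op Q)) := by
  have := hQ.finite
  refine preservesColimitsOfShape_nat_of_elements _ ?_ ?_
  · intro F c hc g
    let ev (m : ℕ) : CSet ⥤ Type := (evaluation _ _).obj (.op (cube m))
    let D := Fin (d + d + 1)
    have h₁ : ∀ᶠ i in Filter.atTop, ∀ (r : D) (x : Q.obj (.op (cube r))),
        ∃ y : (F.obj i).obj (.op (cube r)), (c.ι.app i).app _ y = g.app _ x := by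
      rw [Filter.eventually_all]
      intro r
      rw [Filter.eventually_all]
      intro x
      exact exists_stage hc (ev r) (g.app _ x)
    obtain ⟨i, hi⟩ := h₁.exists
    choose y hy using hi
    have h₂ : ∀ᶠ j in Filter.atTop, ∀ (r s : D) (u : bip r ⟶ bip s) (x : Q.obj (.op (cube r)))
        (hj : i ≤ j), (F.map (homOfLE hj)).app _ (y s (Q.map u.op.op x)) =
          (F.map (homOfLE hj)).app _ ((F.obj i).map u.op.op (y r x)) := by
      rw [Filter.eventually_all]
      intro r
      rw [Filter.eventually_all]
      intro s
      rw [Filter.eventually_all]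
      intro u
      rw [Filter.eventually_all]
      intro x
      refine eventually_eq_of_colimit hc (ev s) _ _ ?_
      refine (hy s _).trans ?_
      refine Eq.trans ?_ (NatTrans.naturality_apply (c.ι.app i) u.op.op (y r x)).symm
      rw [hy, NatTrans.naturality_apply]
      rfl
    obtain ⟨j, hj, hij⟩ := (h₂.and (Filter.eventually_ge_atTop i)).exists
    obtain ⟨g', hg'⟩ := hQ.exists_extension (Y := F.obj j)
      (fun r hr x => (F.map (homOfLE hij)).app _ (y ⟨r, by lia⟩ x))
      (fun r hr s hs u x => by
        rw [← NatTrans.naturality_apply]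
        exact hj ⟨r, by lia⟩ ⟨s, by lia⟩ u x hij)
    refine ⟨j, g', ?_⟩
    refine hQ.hom_ext fun r hr x => ?_
    have h₃ := hg' r hr x
    refine (NatTrans.comp_app_apply g' (c.ι.app j) _ x).trans ?_
    rw [h₃]
    have h₄ : F.map (homOfLE hij) ≫ c.ι.app j = c.ι.app i := c.w _
    refine (NatTrans.comp_app_apply _ (c.ι.app j) _ _).symm.trans ?_
    rw [h₄]
    exact hy ⟨r, by lia⟩ x
  · intro F c hc i g g' h
    let ev (m : ℕ) : CSet ⥤ Type := (evaluation _ _).obj (.op (cube m))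
    have h₁ : ∀ᶠ j in Filter.atTop, ∀ (r : Fin (d + 1)) (x : Q.obj (.op (cube r)))
        (hj : i ≤ j), (F.map (homOfLE hj)).app _ (g.app _ x) =
          (F.map (homOfLE hj)).app _ (g'.app _ x) := by
      rw [Filter.eventually_all]
      intro r
      rw [Filter.eventually_all]
      intro x
      exact eventually_eq_of_colimit hc (ev r) _ _
        (ConcreteCategory.congr_hom (NatTrans.congr_app h (.op (cube r))) x)
    obtain ⟨j, hj, hij⟩ := (h₁.and (Filter.eventually_ge_atTop i)).exists
    exact ⟨j, hij, hQ.hom_ext fun r hr x => hj ⟨r, by lia⟩ x hij⟩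

/-- A cubical set with two jointly injective maps to cubes is finite. -/
lemma of_maps_to_cubes {N M : ℕ} (f : Q ⟶ II N) (g : Q ⟶ II M)
    (hfg : ∀ m (x y : Q.obj (.op (cube m))), f.app _ x = f.app _ y → g.app _ x = g.app _ y →
      x = y) : IsFiniteOfDim Q (N + M) where
  finite m := by
    have h (N : ℕ) : Finite ((II N).obj (.op (cube m))) :=
      Finite.of_injective (β := bip N ⟶ bip m) (fun x => Quiver.Hom.unop x) fun _ _ h =>
        Quiver.Hom.unop_inj h
    have := h N
    have := h M
    exact Finite.of_injective (fun x => (f.app _ x, g.app _ x)) fun x y h =>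
      hfg m x y (congrArg Prod.fst h) (congrArg Prod.snd h)
  exists_degeneracy m x := by
    -- The idempotent `l ≫ k` fixes both images of `x`, hence `x` itself by joint injectivity; so
    -- `x` comes from its restriction along `l`.
    obtain ⟨t, ht, k, l, -, hu, hv⟩ := exists_bip_joint_image (Quiver.Hom.unop (f.app _ x))
      (Quiver.Hom.unop (g.app _ x))
    refine ⟨t, ht, k, Q.map l.op.op x, hfg _ _ _ ?_ ?_⟩
    · rw [NatTrans.naturality_apply, NatTrans.naturality_apply]
      exact congrArg Quiver.Hom.op ((Category.assoc _ _ _).trans hu)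
    · rw [NatTrans.naturality_apply, NatTrans.naturality_apply]
      exact congrArg Quiver.Hom.op ((Category.assoc _ _ _).trans hv)

/-- Exponentiation by a finite cubical set preserves colimits of sequences if the products of the
set with the cubes are finite. -/
lemma preservesColimitsOfShape_ihom {P : CSet} {d : ℕ → ℕ}
    (hP : ∀ k, IsFiniteOfDim (P ⊗ II k) (d k)) : PreservesColimitsOfShape ℕ (ihom P) := by
  refine preservesColimitsOfShape_of_evaluation _ _ fun U => ?_
  have := (hP U.unop.unop).preservesColimitsOfShape_coyoneda
  -- By Yoneda and transposition, the `k`-cubes of `X^P` are the maps `P × Iᵏ ⟶ X`.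
  let i : coyoneda.obj (.op (P ⊗ II U.unop.unop)) ≅ ihom P ⋙ (evaluation _ _).obj U :=
    NatIso.ofComponents
      (fun X => (((ihom.adjunction P).homEquiv (II U.unop.unop) X).trans yonedaEquiv).toIso)
      (fun {X Y} f => by
        ext g
        change yonedaEquiv (MonoidalClosed.curry (g ≫ f)) =
          ((ihom P).map f).app U (yonedaEquiv (MonoidalClosed.curry g))
        rw [MonoidalClosed.curry_natural_right, yonedaEquiv_comp])
  exact preservesColimitsOfShape_of_natIso i

end IsFiniteOfDim

lemma isFiniteOfDim_tensor {P : CSet} {N : ℕ} (f : P ⟶ II N) [Mono f] (k : ℕ) :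
    IsFiniteOfDim (P ⊗ II k) (N + k) :=
  IsFiniteOfDim.of_maps_to_cubes (CartesianMonoidalCategory.fst _ _ ≫ f)
    (CartesianMonoidalCategory.snd _ _) fun m x y h₁ h₂ => by
      have hf : Function.Injective (f.app (.op (cube m))) :=
        (mono_iff_injective _).1 inferInstance
      exact Prod.ext (hf h₁) h₂

/-! ### Sequential continuity of the constituents of `Ṫ` -/

instance (n : ℕ) (e : Bool) : Mono (boxι n e) := inferInstanceAs (Mono (boxSub n e).ι)

instance (n : ℕ) (e : Bool) : PreservesColimitsOfShape ℕ (ihom (box n e)) :=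
  IsFiniteOfDim.preservesColimitsOfShape_ihom (isFiniteOfDim_tensor (boxι n e))

instance (n : ℕ) : PreservesColimitsOfShape ℕ (ihom (II n)) :=
  IsFiniteOfDim.preservesColimitsOfShape_ihom (isFiniteOfDim_tensor (𝟙 (II n)))

instance (n : ℕ) (e : Bool) : PreservesColimitsOfShape ℕ (squares n e) := by
  refine preservesColimitsOfShape_of_evaluation _ _ fun U => ?_
  have h := (IsPullback.of_hasPullback (Functor.whiskerRight Arrow.leftToRight (ihom (box n e)))
    (Functor.whiskerLeft Arrow.rightFunc (MonoidalClosed.pre (boxι n e)))).map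
      ((Functor.whiskeringRight _ _ _).obj ((evaluation _ _).obj U))
  have h₁ : PreservesColimitsOfShape ℕ ((Arrow.leftFunc ⋙ ihom (box n e)) ⋙
    (evaluation _ _).obj U) := inferInstance
  have h₂ : PreservesColimitsOfShape ℕ ((Arrow.rightFunc ⋙ ihom (box n e)) ⋙
    (evaluation _ _).obj U) := inferInstance
  have h₃ : PreservesColimitsOfShape ℕ ((Arrow.rightFunc ⋙ ihom (II (n + 1))) ⋙
    (evaluation _ _).obj U) := inferInstance
  exact @preservesColimitsOfShape_nat_of_isPullback _ _ _ _ _ _ _ _ _ _ h h₁ h₃ h₂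

instance (n : ℕ) (e : Bool) : PreservesColimitsOfShape ℕ (attachSource n e) := by
  have : ∀ k, PreservesColimitsOfShape ℕ ((pair (squares n e ⋙ tensorLeft (box n e))
    ((Arrow.leftFunc ⋙ ihom (II n)) ⋙ tensorLeft (II (n + 1)))).obj k)
    | ⟨.left⟩ => inferInstanceAs (PreservesColimitsOfShape ℕ (squares n e ⋙ tensorLeft (box n e)))
    | ⟨.right⟩ => inferInstanceAs (PreservesColimitsOfShape ℕ
        ((Arrow.leftFunc ⋙ ihom (II n)) ⋙ tensorLeft (II (n + 1))))
  exact preservesColimitsOfShape_colimit _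

instance : PreservesColimitsOfShape ℕ sumSource := by
  have : ∀ k, PreservesColimitsOfShape ℕ ((Discrete.functor
    fun p : ℕ × Bool => attachSource p.1 p.2).obj k) :=
    fun k => inferInstanceAs (PreservesColimitsOfShape ℕ (attachSource k.as.1 k.as.2))
  exact preservesColimitsOfShape_colimit _

instance : PreservesColimitsOfShape ℕ sumTarget := by
  have : ∀ k, PreservesColimitsOfShape ℕ ((Discrete.functor
    fun p : ℕ × Bool => squares p.1 p.2 ⋙ tensorLeft (II (p.1 + 1))).obj k) :=
    fun k => inferInstanceAs (PreservesColimitsOfShape ℕ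
      (squares k.as.1 k.as.2 ⋙ tensorLeft (II (k.as.1 + 1))))
  exact preservesColimitsOfShape_colimit _

instance : PreservesColimitsOfShape ℕ tDotObj := by
  have : ∀ k, PreservesColimitsOfShape ℕ ((span sumLeft sumTop).obj k)
    | none => inferInstanceAs (PreservesColimitsOfShape ℕ sumSource)
    | some .left => inferInstanceAs (PreservesColimitsOfShape ℕ sumTarget)
    | some .right => inferInstanceAs (PreservesColimitsOfShape ℕ (Arrow.leftFunc : Arrow CSet ⥤ _))
  exact preservesColimitsOfShape_colimit _

/-- Colimits of arrows are computed on domains and codomains: the former is `tDotObj`, the latter is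
left unchanged by `Ṫ`. -/
instance preservesColimitsOfShape_tDot : PreservesColimitsOfShape ℕ tDot where
  preservesColimit {F} := ⟨fun {c} hc => by
    have h₁ : IsColimit (Arrow.leftFunc.mapCocone (tDot.mapCocone c)) :=
      isColimitOfPreserves tDotObj hc
    have h₂ : IsColimit ((Arrow.rightFunc : Arrow CSet ⥤ CSet).mapCocone c) :=
      isColimitOfPreserves Arrow.rightFunc hc
    exact ⟨Comma.fstSndJointlyReflectColimit (F := F ⋙ tDot) h₁ h₂⟩⟩

end

noncomputable section

/-! ### Composition of fibration structures, and the factorization by free fibrations -/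

namespace UniformKanStructure

variable {X Y Z W X' Y' Z' : CSet}

/-- The square `(u, v)` from `f` to `g` preserves the chosen fillers. -/
structure IsFillMap {f : X ⟶ Y} {g : X' ⟶ Y'} (φ : UniformKanStructure f)
    (ψ : UniformKanStructure g) (u : X ⟶ X') (v : Y ⟶ Y') : Prop where
  comm : u ≫ g = f ≫ v
  map_fill : ∀ (n : ℕ) (e : Bool) (k : ℕ) (a : II k ⊗ II (n + 1) ⟶ Y) (b : II k ⊗ box n e ⟶ X)
    (w : b ≫ f = II k ◁ boxι n e ≫ a), φ.fill n e k a b w ≫ u =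
      ψ.fill n e k (a ≫ v) (b ≫ u) (by rw [Category.assoc, comm, reassoc_of% w])

lemma IsFillMap.id {f : X ⟶ Y} (φ : UniformKanStructure f) : φ.IsFillMap φ (𝟙 X) (𝟙 Y) where
  comm := by simp
  map_fill := by intros; simp

lemma IsFillMap.trans {f : X ⟶ Y} {g : X' ⟶ Y'} {h : Z ⟶ Z'} {φ : UniformKanStructure f}
    {ψ : UniformKanStructure g} {χ : UniformKanStructure h} {u : X ⟶ X'} {v : Y ⟶ Y'}
    {u' : X' ⟶ Z} {v' : Y' ⟶ Z'} (h₁ : φ.IsFillMap ψ u v) (h₂ : ψ.IsFillMap χ u' v') :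
    φ.IsFillMap χ (u ≫ u') (v ≫ v') where
  comm := by rw [Category.assoc, h₂.comm, reassoc_of% h₁.comm]
  map_fill n e k a b w := by
    rw [← Category.assoc, h₁.map_fill, h₂.map_fill]
    simp only [Category.assoc]

/-- The composite of two fibration structures: fill in the base first. -/
def comp {f : X ⟶ Y} {g : Y ⟶ Z} (φ : UniformKanStructure f) (ψ : UniformKanStructure g) :
    UniformKanStructure (f ≫ g) where
  fill n e k a b w := φ.fill n e k (ψ.fill n e k a (b ≫ f) (by rw [Category.assoc, w])) b
    (ψ.fill_upper n e k _ _ _).symm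
  fill_upper n e k a b w := φ.fill_upper n e k _ b _
  fill_lower n e k a b w := by rw [← Category.assoc, φ.fill_lower, ψ.fill_lower]
  fill_natural n e j k α a b w := by
    rw [φ.fill_natural]
    congr 1
    rw [ψ.fill_natural]
    simp only [Category.assoc]

/-- A degenerate box is also degenerate in the base, where `ψ` fills it degenerately; what is left
for `φ` is again a degenerate problem. -/
lemma IsNormal.comp {f : X ⟶ Y} {g : Y ⟶ Z} {φ : UniformKanStructure f}
    {ψ : UniformKanStructure g} (hφ : φ.IsNormal) (hψ : ψ.IsNormal) : (φ.comp ψ).IsNormal := by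
  intro n e k c
  have h := hψ n e k (c ≫ f)
  have h' := hφ n e k c
  simp only [UniformKanStructure.comp, Category.assoc] at h ⊢
  simp only [h, h']

lemma IsFillMap.comp {f : X ⟶ Y} {g : Y ⟶ Z} {f' : X' ⟶ Y'} {g' : Y' ⟶ Z'}
    {φ : UniformKanStructure f} {ψ : UniformKanStructure g} {φ' : UniformKanStructure f'}
    {ψ' : UniformKanStructure g'} {u : X ⟶ X'} {v : Y ⟶ Y'} {w : Z ⟶ Z'}
    (h₁ : φ.IsFillMap φ' u v) (h₂ : ψ.IsFillMap ψ' v w) :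
    (φ.comp ψ).IsFillMap (φ'.comp ψ') u w where
  comm := by rw [← Category.assoc, h₁.comm, Category.assoc, h₂.comm, Category.assoc]
  map_fill n e k a b w := by
    simp only [UniformKanStructure.comp]
    rw [h₁.map_fill]
    congr 1
    rw [h₂.map_fill]
    simp only [Category.assoc, h₁.comm]

lemma isFillMap_comp_right {f : X ⟶ Y} {g : Y ⟶ Z} (φ : UniformKanStructure f)
    (ψ : UniformKanStructure g) : (φ.comp ψ).IsFillMap ψ f (𝟙 Z) where
  comm := (Category.comp_id _).symm
  map_fill n e k a b w := by
    simp only [UniformKanStructure.comp, Category.comp_id]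
    exact φ.fill_lower _ _ _ _ _ _

/-- The intermediate filler chosen by `ψ` disappears on composing with `g`, since it lies over the
given `a`. This serves the right counit law. -/
lemma IsFillMap.comp_left {f : X ⟶ Y} {g : Y ⟶ Z} {f' : X' ⟶ Z'} {φ : UniformKanStructure f}
    {φ' : UniformKanStructure f'} {u : X ⟶ X'} {w : Z ⟶ Z'} (h : φ.IsFillMap φ' u (g ≫ w))
    (ψ : UniformKanStructure g) : (φ.comp ψ).IsFillMap φ' u w where
  comm := by rw [h.comm, Category.assoc]
  map_fill n e k a b hw := by
    simp only [UniformKanStructure.comp]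
    rw [h.map_fill]
    congr 1
    rw [← Category.assoc, ψ.fill_lower]

lemma isFillMap_comp_assoc {f : X ⟶ Y} {g : Y ⟶ Z} {h : Z ⟶ W} (φ : UniformKanStructure f)
    (ψ : UniformKanStructure g) (χ : UniformKanStructure h) :
    ((φ.comp ψ).comp χ).IsFillMap (φ.comp (ψ.comp χ)) (𝟙 X) (𝟙 W) where
  comm := by simp
  map_fill n e k a b hw := by
    simp [UniformKanStructure.comp]

end UniformKanStructure

open UniformKanStructure

/-- A free normal uniform Kan fibration on `f` with the same codomain as `f`. -/
structure FreeKan {X Y : CSet} (f : X ⟶ Y) where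
  E : CSet
  L : X ⟶ E
  R : E ⟶ Y
  fac : L ≫ R = f
  str : UniformKanStructure R
  normal : str.IsNormal
  exists_lift : ∀ {A B : CSet} {q : A ⟶ B} (φ : UniformKanStructure q), φ.IsNormal →
    ∀ (x : X ⟶ A) (y : Y ⟶ B), x ≫ q = f ≫ y → ∃ k : E ⟶ A, str.IsFillMap φ k y ∧ L ≫ k = x
  hom_ext : ∀ {A B : CSet} {q : A ⟶ B} (φ : UniformKanStructure q), φ.IsNormal →
    ∀ {y : Y ⟶ B} {k k' : E ⟶ A}, str.IsFillMap φ k y → str.IsFillMap φ k' y →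
      L ≫ k = L ≫ k' → k = k'

namespace FreeKan

variable (F : ∀ {X Y : CSet} (f : X ⟶ Y), FreeKan f) {X Y X' Y' X'' Y'' : CSet}

section map

variable {f : X ⟶ Y} {g : X' ⟶ Y'} {h : X'' ⟶ Y''}

lemma exists_map (u : X ⟶ X') (v : Y ⟶ Y') (w : u ≫ g = f ≫ v) :
    ∃ k : (F f).E ⟶ (F g).E, (F f).str.IsFillMap (F g).str k v ∧ (F f).L ≫ k = u ≫ (F g).L :=
  (F f).exists_lift (F g).str (F g).normal (u ≫ (F g).L) v (by rw [Category.assoc, (F g).fac, w])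

variable (u : X ⟶ X') (v : Y ⟶ Y') (w : u ≫ g = f ≫ v)

/-- The map of free fibrations induced by a square. -/
def map : (F f).E ⟶ (F g).E := (exists_map F u v w).choose

lemma map_fillMap : (F f).str.IsFillMap (F g).str (map F u v w) v :=
  (exists_map F u v w).choose_spec.1

lemma L_map : (F f).L ≫ map F u v w = u ≫ (F g).L :=
  (exists_map F u v w).choose_spec.2

lemma map_R : map F u v w ≫ (F g).R = (F f).R ≫ v := (map_fillMap F u v w).comm

/-- This and the later laws share one argument: both sides preserve fillers and agree after `L`, so
`hom_ext` applies. The left unit law `L_mul` instead holds by construction of the multiplication. -/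
lemma map_id : map F (𝟙 X) (𝟙 Y) ((Category.id_comp f).trans (Category.comp_id f).symm) = 𝟙 _ :=
  (F f).hom_ext _ (F f).normal (map_fillMap F _ _ _) (IsFillMap.id _) (by simp [L_map])

variable (u' : X' ⟶ X'') (v' : Y' ⟶ Y'') (w' : u' ≫ h = g ≫ v')

lemma map_comp : map F (u ≫ u') (v ≫ v') (by rw [Category.assoc, w', reassoc_of% w]) =
    map F u v w ≫ map F u' v' w' :=
  (F f).hom_ext _ (F h).normal (map_fillMap F _ _ _)
    ((map_fillMap F _ _ _).trans (map_fillMap F _ _ _)) (by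
      rw [L_map, ← Category.assoc (F f).L, L_map, Category.assoc, Category.assoc, L_map])

end map

variable (f : X ⟶ Y) (g : X' ⟶ Y')

lemma exists_mul : ∃ k : (F (F f).R).E ⟶ (F f).E,
    (F (F f).R).str.IsFillMap (F f).str k (𝟙 Y) ∧ (F (F f).R).L ≫ k = 𝟙 _ :=
  (F (F f).R).exists_lift (F f).str (F f).normal (𝟙 _) (𝟙 _) (by simp)

/-- The multiplication of the monad of free fibrations. -/
def mul : (F (F f).R).E ⟶ (F f).E := (exists_mul F f).choose

lemma mul_fillMap : (F (F f).R).str.IsFillMap (F f).str (mul F f) (𝟙 Y) :=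
  (exists_mul F f).choose_spec.1

lemma L_mul : (F (F f).R).L ≫ mul F f = 𝟙 _ := (exists_mul F f).choose_spec.2

lemma mul_assoc : map F (mul F f) (𝟙 Y) (mul_fillMap F f).comm ≫ mul F f =
    mul F (F f).R ≫ mul F f :=
  (F (F (F f).R).R).hom_ext _ (F f).normal ((map_fillMap F _ _ _).trans (mul_fillMap F _))
    ((mul_fillMap F _).trans (mul_fillMap F _)) (by
      rw [← Category.assoc, L_map, Category.assoc, L_mul, ← Category.assoc, L_mul]; simp)

lemma mul_right_unit : map F (F f).L (𝟙 Y) ((F f).fac.trans (Category.comp_id f).symm) ≫ mul F f =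
    𝟙 _ :=
  (F f).hom_ext (y := 𝟙 Y) _ (F f).normal
    (by simpa using (map_fillMap F _ _ _).trans (mul_fillMap F f)) (IsFillMap.id _) (by
      rw [← Category.assoc, L_map, Category.assoc, L_mul])

variable {f g}

lemma mul_naturality (u : X ⟶ X') (v : Y ⟶ Y') (w : u ≫ g = f ≫ v) :
    map F (map F u v w) v (map_R F u v w) ≫ mul F g = mul F f ≫ map F u v w :=
  (F (F f).R).hom_ext (y := v) _ (F g).normal
    (by simpa using (map_fillMap F _ _ _).trans (mul_fillMap F g))
    (by simpa using (mul_fillMap F f).trans (map_fillMap F u v w)) (by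
      rw [← Category.assoc, L_map, Category.assoc, L_mul, ← Category.assoc, L_mul]; simp)

variable (f g)

/-- The composite of `R (L f)` and `R f` is again a normal fibration, and `L (L f)` maps `f` into it
over `Y`; freeness gives the lift. -/
lemma exists_comul : ∃ k : (F f).E ⟶ (F (F f).L).E,
    (F f).str.IsFillMap ((F (F f).L).str.comp (F f).str) k (𝟙 Y) ∧ (F f).L ≫ k = (F (F f).L).L :=
  (F f).exists_lift ((F (F f).L).str.comp (F f).str) ((F (F f).L).normal.comp (F f).normal) _ _ (by
    rw [← Category.assoc, (F (F f).L).fac, (F f).fac, Category.comp_id])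

/-- The comultiplication of the comonad of left factors. -/
def comul : (F f).E ⟶ (F (F f).L).E := (exists_comul F f).choose

lemma comul_fillMap :
    (F f).str.IsFillMap ((F (F f).L).str.comp (F f).str) (comul F f) (𝟙 Y) :=
  (exists_comul F f).choose_spec.1

lemma L_comul : (F f).L ≫ comul F f = (F (F f).L).L := (exists_comul F f).choose_spec.2

lemma comul_left_counit : comul F f ≫ (F (F f).L).R = 𝟙 _ :=
  (F f).hom_ext (y := 𝟙 Y) _ (F f).normal
    (by simpa using (comul_fillMap F f).trans (isFillMap_comp_right _ _)) (IsFillMap.id _) (by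
      rw [← Category.assoc, L_comul, (F (F f).L).fac, Category.comp_id])

lemma comul_right_counit : comul F f ≫ map F (𝟙 X) (F f).R
    ((Category.id_comp f).trans (F f).fac.symm) = 𝟙 _ :=
  (F f).hom_ext (y := 𝟙 Y) _ (F f).normal
    (by simpa using (comul_fillMap F f).trans (IsFillMap.comp_left (w := 𝟙 Y) (by
      simpa using map_fillMap F (𝟙 X) (F f).R ((Category.id_comp f).trans (F f).fac.symm)) _))
    (IsFillMap.id _) (by
      rw [← Category.assoc, L_comul, L_map, Category.id_comp, Category.comp_id])

lemma coassoc : comul F f ≫ map F (𝟙 X) (comul F f)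
    ((Category.id_comp _).trans (L_comul F f).symm) = comul F f ≫ comul F (F f).L := by
  refine (F f).hom_ext (y := 𝟙 Y)
    ((F (F (F f).L).L).str.comp ((F (F f).L).str.comp (F f).str))
    ((F (F (F f).L).L).normal.comp ((F (F f).L).normal.comp (F f).normal)) ?_ ?_ ?_
  · simpa using (comul_fillMap F f).trans ((map_fillMap F (𝟙 X) (comul F f)
      ((Category.id_comp _).trans (L_comul F f).symm)).comp (comul_fillMap F f))
  · simpa using ((comul_fillMap F f).trans ((comul_fillMap F (F f).L).comp
      (IsFillMap.id (F f).str))).trans (isFillMap_comp_assoc _ _ _)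
  · have h := reassoc_of% L_comul F f
    exact (h _).trans ((L_map F _ _ _).trans (by rw [h, L_comul, Category.id_comp]))

variable {f g}

lemma comul_naturality (u : X ⟶ X') (v : Y ⟶ Y') (w : u ≫ g = f ≫ v) :
    map F u v w ≫ comul F g = comul F f ≫ map F u (map F u v w) (L_map F u v w).symm := by
  refine (F f).hom_ext (y := v) ((F (F g).L).str.comp (F g).str)
    ((F (F g).L).normal.comp (F g).normal) ?_ ?_ ?_
  · simpa using (map_fillMap F u v w).trans (comul_fillMap F g)
  · simpa using (comul_fillMap F f).trans ((map_fillMap F u (map F u v w)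
      (L_map F u v w).symm).comp (map_fillMap F u v w))
  · have h := reassoc_of% L_map F u v w
    have h' := reassoc_of% L_comul F f
    exact ((h _).trans (by rw [L_comul])).trans ((h' _).trans (L_map F _ _ _)).symm

/-- The functorial factorization by free fibrations. -/
def factorization : FunctorialFactorization CSet where
  E :=
    { obj f := (F (X := f.left) (Y := f.right) f.hom).E
      map h := map F h.left h.right h.w
      map_id f := map_id F (f := f.hom)
      map_comp h h' := map_comp F h.left h.right h.w h'.left h'.right h'.w }
  L :=
    { app f := (F (X := f.left) (Y := f.right) f.hom).L
      naturality f g h := (L_map F h.left h.right h.w).symm }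
  R :=
    { app f := (F (X := f.left) (Y := f.right) f.hom).R
      naturality f g h := map_R F h.left h.right h.w }
  fac := by
    ext1; ext1 f
    exact (F (X := f.left) (Y := f.right) f.hom).fac

/-- The algebraic weak factorization system of free fibrations. -/
def awfs : AWFS CSet where
  toFunctorialFactorization := factorization F
  μ :=
    { app f := Arrow.homMk (mul F (X := f.left) (Y := f.right) f.hom) (𝟙 f.right)
        (mul_fillMap F (X := f.left) (Y := f.right) f.hom).comm
      naturality f g h := by
        ext1
        · exact mul_naturality F h.left h.right h.w
        · exact (Category.comp_id h.right).trans (Category.id_comp h.right).symm }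
  ν :=
    { app f := Arrow.homMk (𝟙 f.left) (comul F (X := f.left) (Y := f.right) f.hom)
        ((Category.id_comp _).trans (L_comul F (X := f.left) (Y := f.right) f.hom).symm)
      naturality f g h := by
        ext1
        · exact (Category.comp_id h.left).trans (Category.id_comp h.left).symm
        · exact comul_naturality F h.left h.right h.w }
  assoc f := by
    ext1
    · exact mul_assoc F (X := f.left) (Y := f.right) f.hom
    · rfl
  left_unit f := by
    ext1
    · exact L_mul F (X := f.left) (Y := f.right) f.hom
    · exact Category.id_comp (𝟙 f.right)
  right_unit f := by
    ext1
    · exact mul_right_unit F (X := f.left) (Y := f.right) f.hom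
    · exact Category.id_comp (𝟙 f.right)
  coassoc f := by
    ext1
    · rfl
    · exact coassoc F (X := f.left) (Y := f.right) f.hom
  left_counit f := by
    ext1
    · exact Category.id_comp (𝟙 f.left)
    · exact comul_left_counit F (X := f.left) (Y := f.right) f.hom
  right_counit f := by
    ext1
    · exact Category.id_comp (𝟙 f.left)
    · exact comul_right_counit F (X := f.left) (Y := f.right) f.hom

end FreeKan

end

noncomputable section

/-! ### Free normal uniform Kan fibrations from Kelly's sequence -/

/-- The retraction of the point at an identity map. -/
def identityRetraction (Y : CSet) : PointRetraction (Arrow.mk (𝟙 Y)) where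
  map := tDotArrow (Arrow.mk (𝟙 Y))
  incl_map := cellIncl_tDotArrow (Arrow.mk (𝟙 Y))
  map_hom := Category.comp_id (tDotArrow (Arrow.mk (𝟙 Y)))

lemma arrow_hom_ext_identity {A : Arrow CSet} {Y : CSet} {g h : A ⟶ Arrow.mk (𝟙 Y)}
    (w : g.right = h.right) : g = h := by
  have hg : g.left ≫ 𝟙 Y = A.hom ≫ g.right := g.w
  have hh : h.left ≫ 𝟙 Y = A.hom ≫ h.right := h.w
  ext1
  · exact (Category.comp_id g.left).symm.trans
      (hg.trans ((congrArg (A.hom ≫ ·) w).trans (hh.symm.trans (Category.comp_id h.left))))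
  · exact w

/-- A map to an identity arrow is determined by its codomain component, and algebra structures are
trivial there. -/
lemma algebra_comm_identity {A : Arrow CSet} {Y : CSet} (s : tDot.obj A ⟶ A)
    (hs : tDotPoint.app A ≫ s = 𝟙 A) (g : A ⟶ Arrow.mk (𝟙 Y)) :
    s ≫ g = tDot.map g ≫ (identityRetraction Y).algebra := by
  refine arrow_hom_ext_identity ?_
  have h : s.right ≫ g.right = g.right ≫ 𝟙 Y :=
    (congrArg (· ≫ g.right) (PointRetraction.algebra_right s hs)).trans
      ((Category.id_comp g.right).trans (Category.comp_id g.right).symm)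
  exact h

/-- The free algebra on `f` has the same codomain as `f`, up to isomorphism. -/
lemma IsFreePointedAlgebra.exists_inv_right {f A : Arrow CSet} {s : tDot.obj A ⟶ A} {u : f ⟶ A}
    (hu : IsFreePointedAlgebra tDotPoint s u) :
    ∃ d : A.right ⟶ f.right, u.right ≫ d = 𝟙 f.right ∧ d ≫ u.right = 𝟙 A.right := by
  obtain ⟨g, -, hg⟩ := hu.exists_lift (identityRetraction f.right).algebra
    (identityRetraction f.right).point_algebra
    (Arrow.homMk f.hom (𝟙 f.right) rfl : f ⟶ Arrow.mk (𝟙 f.right))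
  obtain ⟨d, hd⟩ : ∃ d : A.right ⟶ f.right, d = g.right := ⟨g.right, rfl⟩
  have h₁ : u.right ≫ d = 𝟙 f.right := by rw [hd]; exact congrArg CommaMorphism.right hg
  refine ⟨d, h₁, ?_⟩
  -- The codomain components of `a` and `b` are the two sides of the remaining equation; both are
  -- algebra maps and they agree after `u`.
  let a : A ⟶ Arrow.mk (𝟙 A.right) := Arrow.homMk A.hom (𝟙 A.right) rfl
  let b : A ⟶ Arrow.mk (𝟙 A.right) :=
    Arrow.homMk (A.hom ≫ d ≫ u.right) (d ≫ u.right) (Category.comp_id (A.hom ≫ d ≫ u.right))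
  have hab : a = b := hu.hom_ext (identityRetraction A.right).algebra
    (identityRetraction A.right).point_algebra a b (algebra_comm_identity s hu.retract a)
    (algebra_comm_identity s hu.retract b) (arrow_hom_ext_identity (by
      have h : u.right ≫ 𝟙 A.right = u.right ≫ d ≫ u.right := by
        rw [← Category.assoc, h₁, Category.id_comp, Category.comp_id]
      exact h))
  exact (congrArg CommaMorphism.right hab).symm

/-- A colimit of Kelly's sequence on `f` whose coprojection from `f` is the identity on
codomains, with its structure of a normal uniform Kan fibration. -/
structure KellyColimit (f : Arrow CSet) where
  E : CSet
  R : E ⟶ f.right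
  κ : kellySequence tDotPoint f ⟶ (Functor.const ℕ).obj (Arrow.mk R)
  isColimit : IsColimit (Cocone.mk (Arrow.mk R) κ)
  L : f.left ⟶ E
  fac : L ≫ R = f.hom
  κ_zero : kellyι (Cocone.mk (Arrow.mk R) κ) 0 =
    (Arrow.homMk L (𝟙 f.right) (fac.trans (Category.comp_id f.hom).symm) : f ⟶ Arrow.mk R)
  retraction : PointRetraction (Arrow.mk R)
  map_κ : ∀ n, tDot.map (kellyι (Cocone.mk (Arrow.mk R) κ) n) ≫ retraction.algebra =
    kellyC tDotPoint f n ≫ kellyι (Cocone.mk (Arrow.mk R) κ) (n + 1)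

/-- An arbitrary colimit of arrows fixes the codomain only up to isomorphism, whereas a
factorization of `f` needs the codomain of `f` itself. The colimit is therefore transported along
the isomorphism found for free algebras. -/
lemma nonempty_kellyColimit (f : Arrow CSet) : Nonempty (KellyColimit f) := by
  obtain ⟨K, ⟨hK⟩⟩ : ∃ K : Cocone (kellySequence tDotPoint f), Nonempty (IsColimit K) :=
    ⟨colimit.cocone _, ⟨colimit.isColimit _⟩⟩
  obtain ⟨u, hu⟩ : ∃ u : f ⟶ K.pt, kellyι K 0 = u := ⟨kellyι K 0, rfl⟩
  obtain ⟨s, hs⟩ := exists_kellyColimit_structure hK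
  obtain ⟨d, hd₁, hd₂⟩ := (isFreePointedAlgebra_of_isColimit hK hs hu).exists_inv_right
  let i : K.pt ≅ Arrow.mk (K.pt.hom ≫ d) :=
    Arrow.isoMk (Iso.refl K.pt.left) (⟨d, u.right, hd₂, hd₁⟩ : K.pt.right ≅ f.right)
      (Category.id_comp (K.pt.hom ≫ d))
  let κ : kellySequence tDotPoint f ⟶ (Functor.const ℕ).obj (Arrow.mk (K.pt.hom ≫ d)) :=
    K.ι ≫ (Functor.const ℕ).map i.hom
  have hκ : IsColimit (Cocone.mk (Arrow.mk (K.pt.hom ≫ d)) κ) :=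
    hK.ofIsoColimit (Cocone.ext i fun n => rfl)
  obtain ⟨r, hr⟩ := exists_kellyColimit_structure hκ
  have hret := (isFreePointedAlgebra_of_isColimit hκ hr rfl).retract
  have huw : u.left ≫ K.pt.hom = f.hom ≫ u.right := u.w
  refine ⟨⟨K.pt.left, K.pt.hom ≫ d, κ, hκ, u.left, ?_, ?_, PointRetraction.ofAlgebra r hret, ?_⟩⟩
  · rw [← Category.assoc, huw, Category.assoc, hd₁, Category.comp_id]
  · have : kellyι (Cocone.mk (Arrow.mk (K.pt.hom ≫ d)) κ) 0 = u ≫ i.hom :=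
      congrArg (· ≫ i.hom) hu
    refine this.trans ?_
    ext1
    · exact Category.comp_id u.left
    · exact hd₁
  · rw [PointRetraction.algebra_ofAlgebra]
    exact hr

namespace KellyColimit

variable {f : Arrow CSet} (D : KellyColimit f)

/-- The unit `(L, 1) : f ⟶ R`. -/
def unit : f ⟶ Arrow.mk D.R :=
  Arrow.homMk D.L (𝟙 f.right) (D.fac.trans (Category.comp_id f.hom).symm)

lemma isFree : IsFreePointedAlgebra tDotPoint D.retraction.algebra D.unit :=
  isFreePointedAlgebra_of_isColimit D.isColimit D.map_κ D.κ_zero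

/-- The colimit of Kelly's sequence is a free normal uniform Kan fibration. -/
def freeKan {X Y : CSet} {f : X ⟶ Y} (D : KellyColimit (Arrow.mk f)) : FreeKan f where
  E := D.E
  L := D.L
  R := D.R
  fac := D.fac
  str := D.retraction.toKan
  normal := D.retraction.toKan_normal
  exists_lift {A B q} φ hφ x y w := by
    obtain ⟨r, rfl⟩ := PointRetraction.exists_ofKan (f := Arrow.mk q) φ hφ
    obtain ⟨g, hg, hu⟩ := D.isFree.exists_lift r.algebra r.point_algebra
      (Arrow.homMk x y w : Arrow.mk f ⟶ Arrow.mk q)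
    -- The unit is the identity on codomains, so the lift has the prescribed lower component.
    have hy : g.right = y :=
      (Category.id_comp (X := Y) g.right).symm.trans (congrArg CommaMorphism.right hu)
    subst hy
    exact ⟨g.left, ⟨g.w, (PointRetraction.map_comm_iff D.retraction r g).1
      ((PointRetraction.algebra_comm_iff D.retraction r g).1 hg.symm)⟩,
      congrArg CommaMorphism.left hu⟩
  hom_ext {A B q} φ hφ y k k' hk hk' h := by
    obtain ⟨r, rfl⟩ := PointRetraction.exists_ofKan (f := Arrow.mk q) φ hφ
    have key (k : D.E ⟶ A) (hk : D.retraction.toKan.IsFillMap r.toKan k y) :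
        D.retraction.algebra ≫ (Arrow.homMk k y hk.comm : Arrow.mk D.R ⟶ Arrow.mk q) =
          tDot.map (Arrow.homMk k y hk.comm : Arrow.mk D.R ⟶ Arrow.mk q) ≫ r.algebra :=
      ((PointRetraction.algebra_comm_iff D.retraction r _).2
        ((PointRetraction.map_comm_iff D.retraction r _).2 hk.map_fill)).symm
    exact congrArg CommaMorphism.left (D.isFree.hom_ext r.algebra r.point_algebra _ _ (key k hk)
      (key k' hk') (by
        ext1
        · exact h
        · rfl))

end KellyColimit

/-- A chosen colimit of Kelly's sequence. -/
def kellyColimit (f : Arrow CSet) : KellyColimit f := (nonempty_kellyColimit f).some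

/-- The algebraic weak factorization system of normal uniform Kan fibrations. -/
def kanAWFS : AWFS CSet := FreeKan.awfs fun {_ _} f => (kellyColimit (Arrow.mk f)).freeKan

/-- The structure of `Ṫ`-algebra on `R f`. -/
def kanStr (f : Arrow CSet) : tDot.obj (kanAWFS.right.obj f) ⟶ kanAWFS.right.obj f :=
  (kellyColimit f).retraction.algebra

lemma isFreePointedAlgebra_kanStr (f : Arrow CSet) :
    IsFreePointedAlgebra tDotPoint (kanStr f) (kanAWFS.monad.η.app f) :=
  (kellyColimit f).isFree

lemma kanStr_map {f g : Arrow CSet} (h : f ⟶ g) :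
    tDot.map (kanAWFS.monad.map h) ≫ kanStr g = kanStr f ≫ kanAWFS.monad.map h :=
  (PointRetraction.algebra_comm_iff (kellyColimit f).retraction (kellyColimit g).retraction _).2
    ((PointRetraction.map_comm_iff (kellyColimit f).retraction (kellyColimit g).retraction _).2
      (FreeKan.map_fillMap (fun {_ _} f => (kellyColimit (Arrow.mk f)).freeKan)
        h.left h.right h.w).map_fill)

lemma kanStr_mul (f : Arrow CSet) :
    tDot.map (kanAWFS.monad.μ.app f) ≫ kanStr f =
      kanStr (kanAWFS.monad.obj f) ≫ kanAWFS.monad.μ.app f :=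
  (PointRetraction.algebra_comm_iff (kellyColimit (Arrow.mk (kellyColimit f).R)).retraction
    (kellyColimit f).retraction _).2
    ((PointRetraction.map_comm_iff (kellyColimit (Arrow.mk (kellyColimit f).R)).retraction
      (kellyColimit f).retraction _).2
      (FreeKan.mul_fillMap (fun {_ _} f => (kellyColimit (Arrow.mk f)).freeKan) f.hom).map_fill)

/-- The map of pointed endofunctors from `Ṫ` to the monad `R`. -/
def tDotToKan : tDot ⟶ kanAWFS.monad.toFunctor where
  app f := tDot.map (kanAWFS.monad.η.app f) ≫ kanStr f
  naturality f g h := by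
    have h₁ : h ≫ kanAWFS.monad.η.app g = kanAWFS.monad.η.app f ≫ kanAWFS.monad.map h :=
      kanAWFS.monad.η.naturality h
    have h₂ : tDot.map h ≫ tDot.map (kanAWFS.monad.η.app g) =
        tDot.map (kanAWFS.monad.η.app f) ≫ tDot.map (kanAWFS.monad.map h) :=
      (tDot.map_comp _ _).symm.trans ((congrArg tDot.map h₁).trans (tDot.map_comp _ _))
    exact (Category.assoc _ _ _).symm.trans ((congrArg (· ≫ kanStr g) h₂).trans
      ((Category.assoc _ _ _).trans ((congrArg (_ ≫ ·) (kanStr_map h)).trans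
        (Category.assoc _ _ _).symm)))

/-- The multiplication is an algebra map between free algebras, so it moves past the structure map;
the left unit law then cancels it against the unit. -/
lemma tDotToKan_mul (f : Arrow CSet) :
    tDotToKan.app (kanAWFS.monad.obj f) ≫ kanAWFS.monad.μ.app f = kanStr f := by
  have h₁ : kanAWFS.monad.η.app (kanAWFS.monad.obj f) ≫ kanAWFS.monad.μ.app f = 𝟙 _ :=
    kanAWFS.monad.left_unit f
  have h₂ : tDot.map (kanAWFS.monad.η.app (kanAWFS.monad.obj f)) ≫
      tDot.map (kanAWFS.monad.μ.app f) = 𝟙 _ :=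
    (tDot.map_comp _ _).symm.trans ((congrArg tDot.map h₁).trans (tDot.map_id _))
  exact (Category.assoc _ _ _).trans ((congrArg (_ ≫ ·) (kanStr_mul f).symm).trans
    ((Category.assoc _ _ _).symm.trans ((congrArg (· ≫ kanStr f) h₂).trans
      (Category.id_comp _))))

/-- Naturality moves the point past the unit, where the free algebra structure retracts it. -/
lemma tDotPoint_tDotToKan : tDotPoint ≫ tDotToKan = kanAWFS.monad.η := by
  ext1; ext1 f
  have h := point_naturality tDotPoint (kanAWFS.monad.η.app f)
  exact (Category.assoc _ _ _).symm.trans ((congrArg (· ≫ kanStr f) h).trans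
    ((Category.assoc _ _ _).trans ((congrArg (kanAWFS.monad.η.app f ≫ ·)
      (isFreePointedAlgebra_kanStr f).retract).trans (Category.comp_id _))))

lemma isKellyColimit_tDotToKan : IsKellyColimit tDotPoint kanAWFS.monad tDotToKan := fun f =>
  ⟨(kellyColimit f).κ, ⟨(kellyColimit f).isColimit⟩, (kellyColimit f).κ_zero, fun n => by
    rw [tDotToKan_mul]
    exact ((kellyColimit f).map_κ n).symm⟩

end

theorem mainTheorem2 :
    ∃ (A : AWFS CSet) (η : tDot ⟶ A.monad.toFunctor),
      (∃ Φ : A.monad.Algebra ⥤ NormalKanFibration,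
        IsIsoOfCategories Φ ∧ Φ ⋙ NormalKanFibration.forget = A.monad.forget) ∧
      PreservesColimitsOfShape ℕ tDot ∧
      IsAlgebraicallyFree tDotPoint A.monad η ∧
      IsKellyColimit tDotPoint A.monad η := by
  have hfree := isAlgebraicallyFree_of_isKellyColimit tDotPoint_tDotToKan isKellyColimit_tDotToKan
  obtain ⟨h, hiso⟩ := hfree
  exact ⟨kanAWFS, tDotToKan, ⟨comparison tDotToKan h ⋙ algebraToKan,
    hiso.comp isIsoOfCategories_algebraToKan, rfl⟩, inferInstance, ⟨h, hiso⟩,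
    isKellyColimit_tDotToKan⟩
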